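/- Let $k$ be a field with $\operatorname{char} k\neq 2$, let $n\ge 3$, and let $Q$ be an invertible symmetric $n\times n$ matrix over $k$ (for example $Q=I_n$). Let $SL_n$ be the special linear group scheme over $k$ and let $SO_n=SO(Q)\subset SL_n$ be the special orthogonal group scheme of $Q$, whose points with values in a $k$-algebra $R$ are the matrices $A\in SL_n(R)$ with $A^TQA=Q$. A quotient $SL_n/SO_n$ is a $k$-scheme $X$ with a $k$-morphism $\pi:SL_n\to X$ that is an $SO_n$-torsor for right multiplication, i.e. $\pi$ is faithfully flat and locally of finite presentation, and $(g,h)\mapsto(g,gh)$ is an isomorphism $SL_n\times SO_n\to SL_n\times_X SL_n$. For a $k$-scheme $S$ let $H^1(S,SO_n)$ be the pointed set of isomorphism classes of $SO_n$-torsors (in the fppf sense) over $S$. Then a quotient $\pi: SL_n\to X=SL_n/SO_n$ exists, and for every such quotient: 1. the $SO_n$-torsor $\pi: SL_n\to SL_n/SO_n$ is not Zariski-locally trivial, i.e. $X$ is not covered by open subschemes over which the torsor is trivial; 2. $X$ is integral and, writing $K$ for its function field, the class in $H^1(K,SO_n)$ of the generic fibre of $\pi$ is not trivial. -/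

import Mathlib

noncomputable section

open CategoryTheory Limits MonoidalCategory CartesianMonoidalCategory AlgebraicGeometry
open scoped MonObj

universe u

/-! ### Torsors under a group scheme, and the pointed set `H¹` -/

/-- A (right) `G`-torsor over the `B`-scheme `S`, for a group scheme `G` over `B`: a morphism
`proj : P ⟶ S` which is faithfully flat and locally of finite presentation, with a right action of
`G` on `P` such that `(p, g) ↦ (p, p · g)` is an isomorphism `P × G ≅ P ×_S P`. -/
structure GTorsor {B : Scheme.{u}} (G : Over B) [GrpObj G] (S : Over B) where
  obj : Over B
  proj : obj ⟶ S
  act : obj ⊗ G ⟶ obj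
  act_one : (obj ◁ η[G]) ≫ act = (ρ_ obj).hom
  act_mul : (act ▷ G) ≫ act = (α_ obj G G).hom ≫ (obj ◁ μ[G]) ≫ act
  isPullback : IsPullback (fst obj G) act proj proj
  flat : Flat proj.left
  surjective : Surjective proj.left
  locallyOfFinitePresentation : LocallyOfFinitePresentation proj.left

namespace GTorsor

/-- Criterion for the square expressing simple transitivity, on points with values in `T`. -/
lemma isPullback_of_existsUnique {B : Scheme.{u}} {G S P : Over B} (proj : P ⟶ S) (act : P ⊗ G ⟶ P)
    (w : act ≫ proj = fst P G ≫ proj)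
    (h : ∀ {T : Over B} (a b : T ⟶ P), a ≫ proj = b ≫ proj → ∃! g : T ⟶ G, lift a g ≫ act = b) :
    IsPullback (fst P G) act proj proj := by
  choose d hd hd' using @h
  refine ⟨⟨w.symm⟩, ⟨PullbackCone.IsLimit.mk _ (fun s ↦ lift s.fst (d _ _ s.condition))
    (fun s ↦ by simp) (fun s ↦ hd _ _ s.condition) ?_⟩⟩
  intro s m h₁ h₂
  have h₃ : m = lift s.fst (m ≫ snd _ _) := by
    rw [← h₁]; ext1 <;> simp
  rw [h₃]
  congr 1
  apply hd'
  rw [← h₃, h₂]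

variable {B : Scheme.{u}} {G : Over B} [GrpObj G] {S : Over B}

/-- Two torsors are isomorphic if there is a `G`-equivariant isomorphism over `S`. -/
def IsIsomorphic (P P' : GTorsor G S) : Prop :=
  ∃ e : P.obj ≅ P'.obj, e.hom ≫ P'.proj = P.proj ∧ P.act ≫ e.hom = (e.hom ▷ G) ≫ P'.act

lemma isIsomorphic_equivalence : Equivalence (IsIsomorphic (G := G) (S := S)) where
  refl P := ⟨Iso.refl _, by simp, by simp⟩
  symm := by
    rintro P P' ⟨e, h₁, h₂⟩
    refine ⟨e.symm, by simp [← h₁], ?_⟩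
    rw [Iso.symm_hom, Iso.comp_inv_eq, Category.assoc, h₂, ← comp_whiskerRight_assoc]
    simp
  trans := by
    rintro P P' P'' ⟨e, h₁, h₂⟩ ⟨e', h₁', h₂'⟩
    refine ⟨e ≪≫ e', by simp [h₁, h₁'], ?_⟩
    rw [Iso.trans_hom, ← Category.assoc, h₂, Category.assoc, h₂', comp_whiskerRight,
      Category.assoc]

lemma existsUnique_act (P : GTorsor G S) {T : Over B} (a b : T ⟶ P.obj)
    (hab : a ≫ P.proj = b ≫ P.proj) : ∃! g : T ⟶ G, lift a g ≫ P.act = b := by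
  refine ⟨P.isPullback.lift a b hab ≫ snd _ _, ?_, ?_⟩
  · have : lift a (P.isPullback.lift a b hab ≫ snd _ _) = P.isPullback.lift a b hab := by
      ext1 <;> simp
    dsimp only
    rw [this]; simp
  · intro g hg
    have : lift a g = P.isPullback.lift a b hab := by
      apply P.isPullback.hom_ext <;> simp [hg]
    rw [← this]; simp

/-- The base change of a torsor along `f : S' ⟶ S`. -/
def baseChange (P : GTorsor G S) {S' : Over B} (f : S' ⟶ S) : GTorsor G S' where
  obj := pullback P.proj f
  proj := pullback.snd P.proj f
  act := pullback.lift ((pullback.fst P.proj f ▷ G) ≫ P.act) (fst _ _ ≫ pullback.snd P.proj f) (by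
    rw [Category.assoc, ← P.isPullback.w, whiskerRight_fst_assoc, pullback.condition,
      Category.assoc])
  act_one := by
    ext1
    · rw [Category.assoc, pullback.lift_fst, whisker_exchange_assoc, P.act_one]
      simp
    · rw [Category.assoc, pullback.lift_snd]
      simp [rightUnitor_hom]
  act_mul := by
    ext1
    · simp only [Category.assoc, pullback.lift_fst, ← comp_whiskerRight_assoc]
      simp only [comp_whiskerRight, Category.assoc, P.act_mul, associator_naturality_left_assoc,
        whisker_exchange_assoc]
    · simp only [Category.assoc, pullback.lift_snd, whiskerRight_fst_assoc, whiskerLeft_fst_assoc,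
        associator_hom_fst_assoc]
  isPullback := by
    apply isPullback_of_existsUnique
    · rw [pullback.lift_snd]
    · intro T a b hab
      obtain ⟨g, hg, hg'⟩ := P.existsUnique_act (a ≫ pullback.fst _ _) (b ≫ pullback.fst _ _) (by
        simp only [Category.assoc, pullback.condition, reassoc_of% hab])
      refine ⟨g, ?_, ?_⟩
      · dsimp only
        ext1
        · rw [Category.assoc, pullback.lift_fst, ← hg]
          simp
        · rw [Category.assoc, pullback.lift_snd, ← hab]
          simp
      · intro g' h
        apply hg'
        rw [← h, Category.assoc, pullback.lift_fst]
        simp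
  flat := by
    have := P.flat
    exact MorphismProperty.of_isPullback
      ((IsPullback.of_hasPullback P.proj f).map (Over.forget B)) ‹Flat P.proj.left›
  surjective := by
    have := P.surjective
    exact MorphismProperty.of_isPullback
      ((IsPullback.of_hasPullback P.proj f).map (Over.forget B)) ‹Surjective P.proj.left›
  locallyOfFinitePresentation := by
    have := P.locallyOfFinitePresentation
    exact MorphismProperty.of_isPullback
      ((IsPullback.of_hasPullback P.proj f).map (Over.forget B))
      ‹LocallyOfFinitePresentation P.proj.left›

lemma IsIsomorphic.baseChange {P P' : GTorsor G S} (h : P.IsIsomorphic P') {S' : Over B}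
    (f : S' ⟶ S) : (P.baseChange f).IsIsomorphic (P'.baseChange f) := by
  obtain ⟨e, h₁, h₂⟩ := h
  have h₁' : e.inv ≫ P.proj = P'.proj := by simp [← h₁]
  let E : pullback P.proj f ≅ pullback P'.proj f :=
    ⟨pullback.lift (pullback.fst _ _ ≫ e.hom) (pullback.snd _ _)
        (by rw [Category.assoc, h₁, pullback.condition]),
      pullback.lift (pullback.fst _ _ ≫ e.inv) (pullback.snd _ _)
        (by rw [Category.assoc, h₁', pullback.condition]),
      pullback.hom_ext
        (by rw [Category.assoc, pullback.lift_fst, pullback.lift_fst_assoc]; simp)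
        (by rw [Category.assoc, pullback.lift_snd, pullback.lift_snd]; simp),
      pullback.hom_ext
        (by rw [Category.assoc, pullback.lift_fst, pullback.lift_fst_assoc]; simp)
        (by rw [Category.assoc, pullback.lift_snd, pullback.lift_snd]; simp)⟩
  have hE₁ : E.hom ≫ pullback.fst _ _ = pullback.fst _ _ ≫ e.hom := pullback.lift_fst _ _ _
  have hE₂ : E.hom ≫ pullback.snd _ _ = pullback.snd _ _ := pullback.lift_snd _ _ _
  refine ⟨E, hE₂, ?_⟩
  apply pullback.hom_ext
  · have h₃ : (P.baseChange f).act ≫ pullback.fst P.proj f = (pullback.fst P.proj f ▷ G) ≫ P.act :=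
      pullback.lift_fst _ _ _
    have h₄ : (P'.baseChange f).act ≫ pullback.fst P'.proj f =
      (pullback.fst P'.proj f ▷ G) ≫ P'.act := pullback.lift_fst _ _ _
    have h₅ : (E.hom ▷ G) ≫ (pullback.fst P'.proj f ▷ G) ≫ P'.act =
        (pullback.fst P.proj f ▷ G) ≫ P.act ≫ e.hom := by
      rw [← comp_whiskerRight_assoc, hE₁, comp_whiskerRight_assoc, h₂]
    refine (Category.assoc _ _ _).trans ((congrArg _ hE₁).trans ?_)
    refine ((Category.assoc _ _ _).symm.trans (congrArg (· ≫ e.hom) h₃)).trans ?_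
    refine (Category.assoc _ _ _).trans (h₅.symm.trans ?_)
    exact (congrArg _ h₄.symm).trans (Category.assoc _ _ _).symm
  · have h₃ : (P.baseChange f).act ≫ pullback.snd P.proj f = fst _ _ ≫ pullback.snd P.proj f :=
      pullback.lift_snd _ _ _
    have h₄ : (P'.baseChange f).act ≫ pullback.snd P'.proj f = fst _ _ ≫ pullback.snd P'.proj f :=
      pullback.lift_snd _ _ _
    have h₅ : (E.hom ▷ G) ≫ fst _ _ ≫ pullback.snd P'.proj f =
        fst _ _ ≫ pullback.snd P.proj f := by
      rw [whiskerRight_fst_assoc, hE₂]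
    refine (Category.assoc _ _ _).trans ((congrArg _ hE₂).trans (h₃.trans (h₅.symm.trans ?_)))
    exact (congrArg _ h₄.symm).trans (Category.assoc _ _ _).symm

lemma lift_trivialAct {T : Over B} (a : T ⟶ S ⊗ G) (g : T ⟶ G) :
    lift a g ≫ (α_ S G G).hom ≫ (S ◁ μ[G]) = lift (a ≫ fst _ _) ((a ≫ snd _ _) * g) := by
  rw [Hom.mul_def]
  ext1
  · simp
  · simp only [Category.assoc, whiskerLeft_snd, lift_snd]
    rw [← Category.assoc, ← Category.assoc]
    congr 1
    ext1 <;> simp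

lemma trivialAct_eq : (α_ S G G).hom ≫ (S ◁ μ[G]) =
    lift (fst (S ⊗ G) G ≫ fst S G) ((fst (S ⊗ G) G ≫ snd S G) * snd (S ⊗ G) G) := by
  rw [← lift_trivialAct, lift_fst_snd, Category.id_comp]

variable (G S) in
/-- The trivial torsor `S × G`, on which `G` acts by right multiplication on the second factor. -/
def trivial [Flat G.hom] [LocallyOfFinitePresentation G.hom] : GTorsor G S where
  obj := S ⊗ G
  proj := fst S G
  act := (α_ S G G).hom ≫ (S ◁ μ[G])
  act_one := by
    ext1 <;> simp [rightUnitor_hom]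
  act_mul := by
    rw [trivialAct_eq]
    simp only [comp_lift, MonObj.comp_mul, whiskerRight_fst_assoc, whiskerRight_snd,
      whiskerLeft_fst_assoc, whiskerLeft_snd, associator_hom_fst_assoc, MonObj.mul_eq_mul,
      lift_fst, lift_snd]
    simp [mul_assoc]
  isPullback := by
    apply isPullback_of_existsUnique
    · simp
    · intro T a b hab
      refine ⟨(a ≫ snd _ _)⁻¹ * (b ≫ snd _ _), ?_, ?_⟩
      · dsimp only
        rw [lift_trivialAct, mul_inv_cancel_left, hab]
        ext1 <;> simp
      · intro g hg
        rw [lift_trivialAct] at hg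
        rw [← hg]
        simp
  flat := inferInstanceAs (Flat (pullback.fst S.hom G.hom))
  surjective := by
    have : Surjective (η[G].left ≫ G.hom) := by
      rw [Over.w]
      exact inferInstanceAs (Surjective (𝟙 B))
    have : Surjective G.hom := Surjective.of_comp η[G].left G.hom
    exact inferInstanceAs (Surjective (pullback.fst S.hom G.hom))
  locallyOfFinitePresentation :=
    inferInstanceAs (LocallyOfFinitePresentation (pullback.fst S.hom G.hom))

variable (G S) in
/-- The set `H¹(S, G)` of isomorphism classes of `G`-torsors over `S`. -/
def H1 : Type (u + 1) :=
  Quotient (⟨IsIsomorphic, isIsomorphic_equivalence⟩ : Setoid (GTorsor G S))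

/-- The class in `H¹(S, G)` of a torsor. -/
def cls (P : GTorsor G S) : H1 G S := Quotient.mk _ P

/-- The restriction map `H¹(S, G) → H¹(S', G)` along `f : S' ⟶ S`. -/
def H1.res {S' : Over B} (f : S' ⟶ S) : H1 G S → H1 G S' :=
  Quotient.map (fun P ↦ P.baseChange f) (fun _ _ h ↦ h.baseChange f)

variable (G S) in
/-- The distinguished element of `H¹(S, G)`, the class of the trivial torsor. -/
def H1.triv [Flat G.hom] [LocallyOfFinitePresentation G.hom] : H1 G S := (trivial G S).cls

end GTorsor

/-- The inclusion of an open subscheme, as a morphism of `B`-schemes. -/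
def openIncl {B : Scheme.{u}} (X : Over B) (U : X.left.Opens) : Over.mk (U.ι ≫ X.hom) ⟶ X :=
  Over.homMk U.ι

/-- The inclusion `Spec K ⟶ X` of the generic point of an integral `B`-scheme `X`, where `K` is the
function field of `X`, as a morphism of `B`-schemes. -/
def genericIncl {B : Scheme.{u}} (X : Over B) [IsIntegral X.left] :
    Over.mk ((X.left.fromSpecStalk (genericPoint X.left) : Spec X.left.functionField ⟶ X.left) ≫
      X.hom) ⟶ X :=
  Over.homMk (X.left.fromSpecStalk (genericPoint X.left))

/-- A torsor is Zariski-locally trivial if every point of the base has an open neighbourhood over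
which the class of the torsor is trivial. -/
def GTorsor.IsZariskiLocallyTrivial {B : Scheme.{u}} {G : Over B} [GrpObj G] [Flat G.hom]
    [LocallyOfFinitePresentation G.hom] {S : Over B} (P : GTorsor G S) : Prop :=
  ∀ x : S.left, ∃ U : S.left.Opens, x ∈ U ∧ GTorsor.H1.res (openIncl S U) P.cls = GTorsor.H1.triv G _

/-- `π : G ⟶ X` exhibits the `B`-scheme `X` as the quotient `G/H` of the group scheme `G` by the
subgroup scheme `i : H ⟶ G`: the morphism `π` is faithfully flat and locally of finite presentation,
and `(g, h) ↦ (g, g h)` is an isomorphism of `G × H` onto `G ×_X G`. -/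
structure IsGroupQuotient {B : Scheme.{u}} {H G : Over B} [GrpObj H] [GrpObj G] (i : H ⟶ G)
    [IsMonHom i] {X : Over B} (π : G ⟶ X) : Prop where
  flat : Flat π.left
  surjective : Surjective π.left
  locallyOfFinitePresentation : LocallyOfFinitePresentation π.left
  isPullback : IsPullback (fst G H) ((G ◁ i) ≫ μ[G]) π π

/-- The `H`-torsor `G ⟶ G/H`, with `H` acting on `G` by right multiplication. -/
def IsGroupQuotient.torsor {B : Scheme.{u}} {H G : Over B} [GrpObj H] [GrpObj G] {i : H ⟶ G}
    [IsMonHom i] {X : Over B} {π : G ⟶ X} (h : IsGroupQuotient i π) : GTorsor H X where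
  obj := G
  proj := π
  act := (G ◁ i) ≫ μ[G]
  act_one := by
    rw [← whiskerLeft_comp_assoc, IsMonHom.one_hom, MonObj.mul_one]
  act_mul := by
    rw [← whiskerLeft_comp_assoc]
    have h : (α_ G H H).hom ≫ snd G (H ⊗ H) = lift (fst _ _ ≫ snd _ _) (snd _ _) := by
      ext1 <;> simp
    simp only [MonObj.mul_eq_mul, MonObj.mul_comp, MonObj.comp_mul, whiskerLeft_fst,
      whiskerLeft_snd, whiskerRight_snd_assoc, associator_hom_fst, whiskerRight_fst,
      reassoc_of% h, lift_fst_assoc, lift_snd_assoc, Category.assoc, mul_assoc]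
  isPullback := h.isPullback
  flat := h.flat
  surjective := h.surjective
  locallyOfFinitePresentation := h.locallyOfFinitePresentation

/-! ### The group schemes `SL_n` and `SO_n` over a field -/

section MatrixGroups

open MvPolynomial Matrix Opposite

variable {k : Type u} [Field k] {n : ℕ}

/-- The ring homomorphism `k → Γ(T, 𝒪_T)` given by the structure morphism of a `k`-scheme `T`. -/
def structureHom (T : Over (Spec (CommRingCat.of k))) : k →+* Γ(T.left, ⊤) :=
  T.hom.appTop.hom.comp (Scheme.ΓSpecIso (CommRingCat.of k)).inv.hom

lemma structureHom_comp {T T' : Over (Spec (CommRingCat.of k))} (f : T' ⟶ T) :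
    f.left.appTop.hom.comp (structureHom T) = structureHom T' := by
  have h := Over.w f
  unfold structureHom
  rw [← RingHom.comp_assoc, ← CommRingCat.hom_comp, ← Scheme.Hom.comp_appTop, h]

/-- The closed subscheme of the affine space of `n × n` matrices over `k` defined by a set of
polynomial equations. -/
def matrixScheme (E : Set (MvPolynomial (Fin n × Fin n) k)) : Over (Spec (CommRingCat.of k)) :=
  Over.mk (Spec.map (CommRingCat.ofHom
    (algebraMap k (MvPolynomial (Fin n × Fin n) k ⧸ Ideal.span E))))

/-- Morphisms of `k`-schemes to an affine `k`-scheme, in terms of global sections. -/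
def overSpecHomEquiv (A : Type u) [CommRing A] [Algebra k A] (T : Over (Spec (CommRingCat.of k))) :
    (T ⟶ Over.mk (Spec.map (CommRingCat.ofHom (algebraMap k A)))) ≃
      {ψ : A →+* Γ(T.left, ⊤) // ψ.comp (algebraMap k A) = structureHom T} where
  toFun f := ⟨f.left.appTop.hom.comp (Scheme.ΓSpecIso (CommRingCat.of A)).inv.hom, by
    rw [← structureHom_comp f, structureHom, RingHom.comp_assoc]
    congr 1
    have := Scheme.ΓSpecIso_inv_naturality (CommRingCat.ofHom (algebraMap k A))
    exact congrArg CommRingCat.Hom.hom this⟩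
  invFun ψ := Over.homMk (T.left.toSpecΓ ≫ Spec.map (CommRingCat.ofHom ψ.1)) (by
    have h : CommRingCat.ofHom (algebraMap k A) ≫ CommRingCat.ofHom ψ.1 =
        (Scheme.ΓSpecIso (CommRingCat.of k)).inv ≫ T.hom.appTop := by
      ext1
      exact ψ.2
    dsimp
    rw [Category.assoc, ← Spec.map_comp, h, Spec.map_comp, ← Scheme.toSpecΓ_naturality_assoc]
    simp)
  left_inv f := by
    apply Over.OverMorphism.ext
    have : T.left.toSpecΓ ≫ Spec.map ((Scheme.ΓSpecIso (CommRingCat.of A)).inv ≫ f.left.appTop) =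
        f.left := by
      rw [Spec.map_comp, ← Scheme.toSpecΓ_naturality_assoc]
      simp
    exact this
  right_inv ψ := by
    apply Subtype.ext
    have : (Scheme.ΓSpecIso (CommRingCat.of A)).inv ≫
        (T.left.toSpecΓ ≫ Spec.map (CommRingCat.ofHom ψ.1)).appTop = CommRingCat.ofHom ψ.1 := by
      simp
    exact congrArg CommRingCat.Hom.hom this

lemma overSpecHomEquiv_comp (A : Type u) [CommRing A] [Algebra k A]
    {T T' : Over (Spec (CommRingCat.of k))} (g : T' ⟶ T)
    (f : T ⟶ Over.mk (Spec.map (CommRingCat.ofHom (algebraMap k A)))) :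
    (overSpecHomEquiv A T' (g ≫ f)).1 = g.left.appTop.hom.comp (overSpecHomEquiv A T f).1 := by
  have h : (g ≫ f).left.appTop = f.left.appTop ≫ g.left.appTop := by
    rw [Over.comp_left, Scheme.Hom.comp_appTop]
  simp only [overSpecHomEquiv, Equiv.coe_fn_mk, h, CommRingCat.hom_comp, RingHom.comp_assoc]

/-- The `T`-points of `matrixScheme E` are the matrices over `Γ(T, 𝒪_T)` which satisfy the
equations in `E`. -/
def matrixSchemeHomEquiv (E : Set (MvPolynomial (Fin n × Fin n) k))
    (T : Over (Spec (CommRingCat.of k))) :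
    (T ⟶ matrixScheme E) ≃ {M : Matrix (Fin n) (Fin n) Γ(T.left, ⊤) //
      ∀ p ∈ E, p.eval₂ (structureHom T) (fun ij ↦ M ij.1 ij.2) = 0} :=
  (overSpecHomEquiv _ T).trans
    { toFun ψ := ⟨Matrix.of fun i j ↦ ψ.1 (Ideal.Quotient.mk _ (X (i, j))), fun p hp ↦ by
        have h : (ψ.1.comp (Ideal.Quotient.mk (Ideal.span E))) =
            eval₂Hom (structureHom T) fun ij ↦ ψ.1 (Ideal.Quotient.mk _ (X (ij.1, ij.2))) := by
          ext x
          · have := RingHom.congr_fun ψ.2 x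
            simp only [RingHom.comp_apply, coe_eval₂Hom, eval₂_C]
            exact this
          · simp
        have h' := congrArg (fun f ↦ f p) h
        simp only [RingHom.comp_apply, coe_eval₂Hom] at h'
        refine h'.symm.trans ?_
        rw [Ideal.Quotient.eq_zero_iff_mem.mpr (Ideal.subset_span hp), map_zero]⟩
      invFun M := ⟨Ideal.Quotient.lift _ (eval₂Hom (structureHom T) fun ij ↦ M.1 ij.1 ij.2) (by
          intro a ha
          have : Ideal.span E ≤ RingHom.ker
              (eval₂Hom (structureHom T) fun ij ↦ M.1 ij.1 ij.2) :=
            Ideal.span_le.mpr fun p hp ↦ M.2 p hp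
          exact this ha), by
        ext x
        exact eval₂_C _ _ x⟩
      left_inv ψ := by
        apply Subtype.ext
        apply Ideal.Quotient.ringHom_ext
        have h := ψ.2
        ext x
        · have := RingHom.congr_fun h x
          exact (eval₂_C _ _ x).trans this.symm
        · simp
      right_inv M := by
        apply Subtype.ext
        ext i j
        exact eval₂_X _ _ _ }

lemma matrixSchemeHomEquiv_comp (E : Set (MvPolynomial (Fin n × Fin n) k))
    {T T' : Over (Spec (CommRingCat.of k))} (g : T' ⟶ T) (f : T ⟶ matrixScheme E) :
    (matrixSchemeHomEquiv E T' (g ≫ f)).1 =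
      (matrixSchemeHomEquiv E T f).1.map g.left.appTop.hom := by
  ext i j
  exact RingHom.congr_fun (overSpecHomEquiv_comp _ g f) _

/-- The universal `n × n` matrix. -/
abbrev univMatrix (k : Type u) [Field k] (n : ℕ) :
    Matrix (Fin n) (Fin n) (MvPolynomial (Fin n × Fin n) k) :=
  Matrix.of fun i j ↦ X (i, j)

/-- The matrix of polynomials `Xᵀ Q X - Q`, for the universal matrix `X`. -/
def formEquations (Q : Matrix (Fin n) (Fin n) k) :
    Matrix (Fin n) (Fin n) (MvPolynomial (Fin n × Fin n) k) :=
  (univMatrix k n)ᵀ * Q.map C * univMatrix k n - Q.map C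

lemma eval₂_det_univMatrix {R : Type*} [CommRing R] (φ : k →+* R) (M : Matrix (Fin n) (Fin n) R) :
    ((univMatrix k n).det - 1).eval₂ φ (fun ij ↦ M ij.1 ij.2) = M.det - 1 := by
  rw [← coe_eval₂Hom, map_sub, map_one, RingHom.map_det]
  congr 2
  ext i j
  simp

lemma eval₂_form_univMatrix {R : Type*} [CommRing R] (φ : k →+* R) (Q : Matrix (Fin n) (Fin n) k)
    (M : Matrix (Fin n) (Fin n) R) (i j : Fin n) :
    (formEquations Q i j).eval₂ φ
      (fun ij ↦ M ij.1 ij.2) = (Mᵀ * Q.map φ * M - Q.map φ) i j := by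
  rw [← coe_eval₂Hom]
  simp [formEquations, Matrix.mul_apply]

/-! #### The special linear group -/

/-- The `k`-scheme `SL_n`: the scheme of `n × n` matrices of determinant one. -/
def SLScheme (k : Type u) [Field k] (n : ℕ) : Over (Spec (CommRingCat.of k)) :=
  matrixScheme {(univMatrix k n).det - 1}

/-- The functor of points `T ↦ SL_n(Γ(T, 𝒪_T))`. -/
def SLFunctor (k : Type u) [Field k] (n : ℕ) : (Over (Spec (CommRingCat.of k)))ᵒᵖ ⥤ GrpCat.{u} where
  obj T := GrpCat.of (Matrix.SpecialLinearGroup (Fin n) Γ(T.unop.left, ⊤))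
  map f := GrpCat.ofHom (Matrix.SpecialLinearGroup.map f.unop.left.appTop.hom)
  map_id T := by
    ext
    rfl
  map_comp f g := by
    ext
    rfl

/-- `SL_n` represents its functor of points. -/
def SLRepresentableBy (k : Type u) [Field k] (n : ℕ) :
    (SLFunctor k n ⋙ forget GrpCat).RepresentableBy (SLScheme k n) where
  homEquiv {T} := (matrixSchemeHomEquiv _ T).trans (Equiv.subtypeEquivRight fun M ↦ by
    simp only [Set.mem_singleton_iff, forall_eq, eval₂_det_univMatrix, sub_eq_zero])
  homEquiv_comp f g := Subtype.ext (matrixSchemeHomEquiv_comp _ f g)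

instance (k : Type u) [Field k] (n : ℕ) : GrpObj (SLScheme k n) :=
  GrpObj.ofRepresentableBy _ _ (SLRepresentableBy k n)

/-! #### The special orthogonal group -/

/-- For a `k`-algebra `R` (with structure map `φ`) the group `SO(Q)(R)` of matrices `A` over `R` with
`Aᵀ Q A = Q` and `det A = 1`. -/
def SOSubgroup {R : Type*} [CommRing R] (φ : k →+* R) (Q : Matrix (Fin n) (Fin n) k) :
    Subgroup (Matrix.SpecialLinearGroup (Fin n) R) where
  carrier := {A | (A : Matrix (Fin n) (Fin n) R)ᵀ * Q.map φ * (A : Matrix (Fin n) (Fin n) R) = Q.map φ}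
  mul_mem' {A B} hA hB := by
    simp only [Set.mem_ofPred_eq] at hA hB ⊢
    calc _ = (B : Matrix (Fin n) (Fin n) R)ᵀ *
        ((A : Matrix (Fin n) (Fin n) R)ᵀ * Q.map φ * (A : Matrix (Fin n) (Fin n) R)) *
          (B : Matrix (Fin n) (Fin n) R) := by
          simp only [Matrix.SpecialLinearGroup.coe_mul, transpose_mul, Matrix.mul_assoc]
      _ = _ := by rw [hA, hB]
  one_mem' := by simp
  inv_mem' {A} hA := by
    simp only [Set.mem_ofPred_eq] at hA ⊢
    have h : (A : Matrix (Fin n) (Fin n) R) * (A⁻¹ : Matrix.SpecialLinearGroup (Fin n) R).1 = 1 := by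
      rw [← Matrix.SpecialLinearGroup.coe_mul, mul_inv_cancel, Matrix.SpecialLinearGroup.coe_one]
    have h' : (A⁻¹ : Matrix.SpecialLinearGroup (Fin n) R).1ᵀ * (A : Matrix (Fin n) (Fin n) R)ᵀ = 1 := by
      rw [← transpose_mul, h, transpose_one]
    calc _ = (A⁻¹ : Matrix.SpecialLinearGroup (Fin n) R).1ᵀ *
          ((A : Matrix (Fin n) (Fin n) R)ᵀ * Q.map φ * (A : Matrix (Fin n) (Fin n) R)) *
            (A⁻¹ : Matrix.SpecialLinearGroup (Fin n) R).1 := by rw [hA]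
      _ = ((A⁻¹ : Matrix.SpecialLinearGroup (Fin n) R).1ᵀ * (A : Matrix (Fin n) (Fin n) R)ᵀ) * Q.map φ *
          ((A : Matrix (Fin n) (Fin n) R) * (A⁻¹ : Matrix.SpecialLinearGroup (Fin n) R).1) := by
        simp only [Matrix.mul_assoc]
      _ = _ := by rw [h, h', Matrix.one_mul, Matrix.mul_one]

/-- The `k`-scheme `SO(Q)`: the scheme of `n × n` matrices `A` with `det A = 1` and
`Aᵀ Q A = Q`. -/
def SOScheme (Q : Matrix (Fin n) (Fin n) k) : Over (Spec (CommRingCat.of k)) :=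
  matrixScheme ({(univMatrix k n).det - 1} ∪
    Set.range fun ij : Fin n × Fin n ↦
      formEquations Q ij.1 ij.2)

/-- The functor of points `T ↦ SO(Q)(Γ(T, 𝒪_T))`. -/
def SOFunctor (Q : Matrix (Fin n) (Fin n) k) : (Over (Spec (CommRingCat.of k)))ᵒᵖ ⥤ GrpCat.{u} where
  obj T := GrpCat.of (SOSubgroup (structureHom T.unop) Q)
  map {T T'} f := GrpCat.ofHom
    (((Matrix.SpecialLinearGroup.map f.unop.left.appTop.hom).comp
      (SOSubgroup (structureHom T.unop) Q).subtype).codRestrict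
        (SOSubgroup (structureHom T'.unop) Q) (by
          rintro ⟨A, hA⟩
          have h : Q.map (structureHom T'.unop) =
              (Q.map (structureHom T.unop)).map f.unop.left.appTop.hom := by
            rw [← structureHom_comp f.unop]
            ext i j
            rfl
          change (A.1.map f.unop.left.appTop.hom)ᵀ * Q.map (structureHom T'.unop) *
            A.1.map f.unop.left.appTop.hom = Q.map (structureHom T'.unop)
          rw [h, ← transpose_map, ← Matrix.map_mul, ← Matrix.map_mul]
          exact congrArg (fun M ↦ M.map f.unop.left.appTop.hom) hA))
  map_id T := by
    ext
    rfl
  map_comp f g := by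
    ext
    rfl

/-- `SO(Q)` represents its functor of points. -/
def SORepresentableBy (Q : Matrix (Fin n) (Fin n) k) :
    (SOFunctor Q ⋙ forget GrpCat).RepresentableBy (SOScheme Q) where
  homEquiv {T} := (matrixSchemeHomEquiv _ T).trans
    { toFun M := ⟨⟨M.1, by
        have := M.2 _ (Or.inl rfl)
        rwa [eval₂_det_univMatrix, sub_eq_zero] at this⟩, by
        have h (i j : Fin n) := M.2 _ (Or.inr ⟨(i, j), rfl⟩)
        simp only [eval₂_form_univMatrix] at h
        exact sub_eq_zero.mp (Matrix.ext h)⟩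
      invFun A := ⟨A.1.1, by
        rintro p (rfl | ⟨⟨i, j⟩, rfl⟩)
        · rw [eval₂_det_univMatrix, sub_eq_zero]
          exact A.1.2
        · rw [eval₂_form_univMatrix]
          exact congrFun (congrFun (sub_eq_zero.mpr A.2) i) j⟩
      left_inv _ := rfl
      right_inv _ := rfl }
  homEquiv_comp f g := Subtype.ext (Subtype.ext (matrixSchemeHomEquiv_comp _ f g))

instance (Q : Matrix (Fin n) (Fin n) k) : GrpObj (SOScheme Q) :=
  GrpObj.ofRepresentableBy _ _ (SORepresentableBy Q)

instance (Q : Matrix (Fin n) (Fin n) k) : Flat (SOScheme Q).hom :=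
  inferInstanceAs (Flat (Spec.map _))

instance (Q : Matrix (Fin n) (Fin n) k) : LocallyOfFinitePresentation (SOScheme Q).hom := by
  change LocallyOfFinitePresentation (Spec.map _)
  rw [LocallyOfFinitePresentation.SpecMap_iff]
  change RingHom.FinitePresentation (algebraMap k _)
  rw [RingHom.finitePresentation_algebraMap, ← Algebra.FinitePresentation.of_finiteType]
  infer_instance

/-- The group isomorphism `SL_n(T) ≃ SL_n(Γ(T, 𝒪_T))`. -/
def SLPoints (k : Type u) [Field k] (n : ℕ) (T : Over (Spec (CommRingCat.of k))) :
    (T ⟶ SLScheme k n) ≃* Matrix.SpecialLinearGroup (Fin n) Γ(T.left, ⊤) where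
  toEquiv := (SLRepresentableBy k n).homEquiv
  map_mul' f g := ((yonedaGrpObjIsoOfRepresentableBy _ (SLFunctor k n)
    (SLRepresentableBy k n)).hom.app (op T)).hom.map_mul f g

/-- The group isomorphism `SO(Q)(T) ≃ SO(Q)(Γ(T, 𝒪_T))`. -/
def SOPoints (Q : Matrix (Fin n) (Fin n) k) (T : Over (Spec (CommRingCat.of k))) :
    (T ⟶ SOScheme Q) ≃* SOSubgroup (structureHom T) Q where
  toEquiv := (SORepresentableBy Q).homEquiv
  map_mul' f g := ((yonedaGrpObjIsoOfRepresentableBy _ (SOFunctor Q)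
    (SORepresentableBy Q)).hom.app (op T)).hom.map_mul f g

/-- The inclusion `SO(Q) ⟶ SL_n` of `k`-group schemes, given on points by `A ↦ A`. -/
def SOIncl (Q : Matrix (Fin n) (Fin n) k) : SOScheme Q ⟶ SLScheme k n :=
  (SLPoints k n (SOScheme Q)).symm (SOPoints Q (SOScheme Q) (𝟙 _)).1

lemma SLPoints_comp_SOIncl (Q : Matrix (Fin n) (Fin n) k) {T : Over (Spec (CommRingCat.of k))}
    (f : T ⟶ SOScheme Q) : SLPoints k n T (f ≫ SOIncl Q) = (SOPoints Q T f).1 := by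
  have h₁ : SLPoints k n T (f ≫ SOIncl Q) =
      Matrix.SpecialLinearGroup.map f.left.appTop.hom (SLPoints k n _ (SOIncl Q)) :=
    (SLRepresentableBy k n).homEquiv_comp f (SOIncl Q)
  have h₂ : (SOPoints Q T (f ≫ 𝟙 _)).1 =
      Matrix.SpecialLinearGroup.map f.left.appTop.hom (SOPoints Q _ (𝟙 _)).1 :=
    congrArg Subtype.val ((SORepresentableBy Q).homEquiv_comp f (𝟙 _))
  rw [h₁, SOIncl, MulEquiv.apply_symm_apply, ← h₂, Category.comp_id]

instance (Q : Matrix (Fin n) (Fin n) k) : IsMonHom (SOIncl Q) where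
  one_hom := by
    apply (SLPoints k n _).injective
    rw [SLPoints_comp_SOIncl, MonObj.one_eq_one, MonObj.one_eq_one, map_one, map_one]
    rfl
  mul_hom := by
    apply (SLPoints k n _).injective
    rw [SLPoints_comp_SOIncl, MonObj.mul_eq_mul, MonObj.mul_eq_mul, MonObj.comp_mul, map_mul,
      map_mul, tensorHom_fst, tensorHom_snd, SLPoints_comp_SOIncl, SLPoints_comp_SOIncl]
    rfl

end MatrixGroups

end

noncomputable section

open CategoryTheory Limits MonoidalCategory CartesianMonoidalCategory AlgebraicGeometry
open scoped MonObj Matrix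

universe u

/-! Put `q = Q⁻¹`. The group `SL_n` acts on symmetric matrices by `A ↦ A q Aᵀ`, and the stabiliser
of `q` is `SO(Q)`. So the quotient should be the affine scheme of symmetric matrices of determinant
`det q`, with the orbit map as projection.

The orbit map is smooth by the infinitesimal criterion, as approximate solutions of `A q Aᵀ = S` can
be corrected when 2 is invertible (`Matrix.exists_lift_congr`). It is surjective because symmetric
matrices of equal nonzero determinant are congruent under `SL_n` over an algebraically closed field
(`Matrix.exists_congr_of_isAlgClosed`). Hence it is a faithfully flat quotient map. Such maps are
regular epimorphisms, so any other quotient is isomorphic to this one. Its coordinate ring embeds in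
the domain `k[SL_n]`, which gives integrality.

A trivialisation of the torsor on an open neighbourhood of the generic point, or at the generic
point itself, yields a section there. Then every field-valued point over the generic point of the
base lifts to `SL_n`. Such a lift makes the symmetric matrix of that point congruent to `q`. A
counterexample is built over `L = E(x_0, ..., x_{n-1})` with `E` algebraically closed: a twist of
`diag(1/(x_1⋯x_{n-1}), x_1, ..., x_{n-1})`. This diagonal form has no nontrivial zero when `n ≥ 3`,
because its coefficients have different exponent parities. Over `L`, however, `q` is equivalent to
the sum of squares, which vanishes on `(1, √-1, 0, ..., 0)`. The point lies over the generic point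
since it specialises, at `x_i = 1`, to the image of the generic point of `SL_n`
(`exists_injective_not_comp_congrHom`). -/

/-! ### Congruence of symmetric matrices and anisotropic diagonal forms. -/

theorem Matrix.exists_eq_mul_transpose {K : Type*} [Field K] [IsAlgClosed K] (h2 : (2 : K) ≠ 0)
    {n : ℕ} {S : Matrix (Fin n) (Fin n) K} (hS : S.IsSymm) :
    ∃ P : Matrix (Fin n) (Fin n) K, S = P * Pᵀ := by
  have : Invertible (2 : K) := invertibleOfNonzero h2
  have hsymm : LinearMap.IsSymm (Matrix.toBilin' S) := by
    refine ⟨fun x y ↦ ?_⟩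
    simp only [Matrix.toBilin'_apply', RingHom.id_apply]
    rw [Matrix.dotProduct_mulVec, ← Matrix.mulVec_transpose, hS.eq, dotProduct_comm]
  obtain ⟨v, hv⟩ := LinearMap.BilinForm.exists_orthogonal_basis hsymm
  let b := v.reindex (finCongr (Module.finrank_fin_fun K))
  let e := Pi.basisFun K (Fin n)
  have h₁ : (e.toMatrix b)ᵀ * S * e.toMatrix b =
      LinearMap.BilinForm.toMatrix b (Matrix.toBilin' S) := by
    have := LinearMap.BilinForm.toMatrix_mul_basis_toMatrix e b (Matrix.toBilin' S)
    rw [← this, LinearMap.BilinForm.toMatrix_basisFun, LinearMap.BilinForm.toMatrix'_toBilin']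
  -- In an orthogonal basis the Gram matrix is diagonal; `w` collects square roots of its entries,
  -- some of which may be zero.
  have h₂ : ∃ w : Fin n → K, LinearMap.BilinForm.toMatrix b (Matrix.toBilin' S) =
      Matrix.diagonal w * (Matrix.diagonal w)ᵀ := by
    choose s hs using fun x : K ↦ IsAlgClosed.exists_eq_mul_self x
    refine ⟨fun i ↦ s (Matrix.toBilin' S (b i) (b i)), ?_⟩
    ext i j
    rw [Matrix.diagonal_transpose, Matrix.diagonal_mul_diagonal, Matrix.diagonal_apply,
      LinearMap.BilinForm.toMatrix_apply]
    split_ifs with hij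
    · rw [← hij, ← hs]
    · have hb (i) : b i = v ((finCongr (Module.finrank_fin_fun K)).symm i) := v.reindex_apply _ i
      rw [hb, hb]
      exact LinearMap.isOrthoᵢ_def.mp hv _ _ ((Equiv.injective _).ne hij)
  obtain ⟨w, hw⟩ := h₂
  have h₃ : b.toMatrix e * e.toMatrix b = 1 := b.toMatrix_mul_toMatrix_flip e
  have h₃' : e.toMatrix b * b.toMatrix e = 1 := e.toMatrix_mul_toMatrix_flip b
  refine ⟨(b.toMatrix e)ᵀ * Matrix.diagonal w, ?_⟩
  calc S = (e.toMatrix b * b.toMatrix e)ᵀ * S * (e.toMatrix b * b.toMatrix e) := by simp [h₃']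
    _ = (b.toMatrix e)ᵀ * ((e.toMatrix b)ᵀ * S * e.toMatrix b) * b.toMatrix e := by
      simp only [Matrix.transpose_mul, Matrix.mul_assoc]
    _ = _ := by
      rw [h₁, hw]
      simp only [Matrix.transpose_mul, Matrix.mul_assoc, Matrix.transpose_transpose]

open MvPolynomial in
-- The `i`-th nonzero term has leading exponent `a i + 2 deg (p i)`, congruent to `a i` modulo 2.
-- These exponents are pairwise distinct, so the largest one occurs in only one term and cannot
-- cancel.
theorem MvPolynomial.eq_zero_of_sum_monomial_mul_sq_eq_zero {σ R J : Type*} [CommRing R] [IsDomain R]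
    [Finite σ] (s : Finset J) (a : J → σ →₀ ℕ)
    (ha : ∀ i ∈ s, ∀ j ∈ s, i ≠ j → ∃ x, ¬ a i x ≡ a j x [MOD 2]) (p : J → MvPolynomial σ R)
    (h : ∑ i ∈ s, monomial (a i) 1 * p i ^ 2 = 0) : ∀ i ∈ s, p i = 0 := by
  classical
  let : LinearOrder σ := IsWellOrder.linearOrder WellOrderingRel
  have : WellFoundedGT σ := Finite.to_wellFoundedGT
  let m : MonomialOrder σ := MonomialOrder.lex
  by_contra! hne
  obtain ⟨i₀, hi₀, hp₀⟩ := hne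
  have hdeg (i) (hi : p i ≠ 0) : m.degree (monomial (a i) 1 * p i ^ 2) =
      a i + 2 • m.degree (p i) := by
    rw [m.degree_mul (by simp) (pow_ne_zero _ hi), m.degree_pow, m.degree_monomial,
      if_neg one_ne_zero]
  obtain ⟨i, hi, hmax⟩ := Finset.exists_max_image (s.filter fun i ↦ p i ≠ 0)
    (fun i ↦ m.toSyn (m.degree (monomial (a i) 1 * p i ^ 2))) ⟨i₀, by simp [hi₀, hp₀]⟩
  simp only [Finset.mem_filter] at hi hmax
  have := congrArg (coeff (m.degree (monomial (a i) 1 * p i ^ 2))) h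
  rw [coeff_sum, Finset.sum_eq_single i, coeff_zero, m.coeff_degree_eq_zero_iff] at this
  · simp [hi.2] at this
  · intro j hj hji
    by_cases hpj : p j = 0
    · simp [hpj]
    apply m.coeff_eq_zero_of_lt
    refine lt_of_le_of_ne (hmax j ⟨hj, hpj⟩) fun heq ↦ ?_
    obtain ⟨x, hx⟩ := ha i hi.1 j hj hji.symm
    have h' := m.toSyn.injective heq
    rw [hdeg i hi.2, hdeg j hpj] at h'
    have h'' := DFunLike.congr_fun h' x
    simp at h''
    apply hx
    unfold Nat.ModEq
    omega
  · exact fun h ↦ absurd hi.1 h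

/-- With `S = P Pᵀ` and `q = R Rᵀ`, the matrix `P R⁻¹` carries `q` to `S` and has determinant `±1`.
Inserting the reflection `diag(-1, 1, ..., 1)` between the factors corrects the sign. -/
theorem Matrix.exists_congr_of_isAlgClosed {K : Type*} [Field K] [IsAlgClosed K] (h2 : (2 : K) ≠ 0)
    {n : ℕ} (hn : 0 < n) {q S : Matrix (Fin n) (Fin n) K} (hq : q.IsSymm) (hS : S.IsSymm)
    (hdet : S.det = q.det) (hne : q.det ≠ 0) :
    ∃ A : Matrix (Fin n) (Fin n) K, A.det = 1 ∧ A * q * A.transpose = S := by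
  obtain ⟨P, rfl⟩ := Matrix.exists_eq_mul_transpose h2 hS
  obtain ⟨R, rfl⟩ := Matrix.exists_eq_mul_transpose h2 hq
  simp only [Matrix.det_mul, Matrix.det_transpose] at hdet hne
  have hR : R.det ≠ 0 := left_ne_zero_of_mul hne
  have key : ∀ J : Matrix (Fin n) (Fin n) K, J * J.transpose = 1 → P.det * J.det = R.det →
      ∃ A : Matrix (Fin n) (Fin n) K, A.det = 1 ∧
        A * (R * R.transpose) * A.transpose = P * P.transpose := by
    intro J hJ hJdet
    have hR' : R⁻¹ * R = 1 := Matrix.nonsing_inv_mul _ hR.isUnit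
    refine ⟨P * J * R⁻¹, ?_, ?_⟩
    · rw [Matrix.det_mul, Matrix.det_mul, hJdet, ← Matrix.det_mul, Matrix.mul_nonsing_inv _ hR.isUnit,
        Matrix.det_one]
    · calc _ = P * J * (R⁻¹ * R) * (R⁻¹ * R).transpose * J.transpose * P.transpose := by
            simp only [Matrix.transpose_mul, Matrix.mul_assoc]
        _ = P * (J * J.transpose) * P.transpose := by
            simp only [hR', Matrix.mul_one, Matrix.transpose_one, Matrix.mul_assoc]
        _ = _ := by rw [hJ, Matrix.mul_one]
  rcases mul_self_eq_mul_self_iff.mp hdet with h | h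
  · exact key 1 (by simp) (by simpa using h)
  · let w : Fin n → K := Function.update 1 ⟨0, hn⟩ (-1)
    refine key (Matrix.diagonal w) ?_ ?_
    · rw [Matrix.diagonal_transpose, Matrix.diagonal_mul_diagonal, ← Matrix.diagonal_one]
      congr 1
      ext i
      by_cases hi : i = ⟨0, hn⟩ <;> simp [w, hi]
    · rw [Matrix.det_diagonal, Finset.prod_update_of_mem (Finset.mem_univ _)]
      simp [h]

/-- One Newton step. The error `N = S - A q Aᵀ` is symmetric and vanishes modulo `I`, so `Δ = ½ N
A⁻ᵀ q⁻¹` makes each of the two linear terms equal to `N / 2`, and the quadratic term dies because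
`I² = 0`. The determinant `d` of `A + Δ` then satisfies `d² = 1` and `(d - 1)² = 0`, whence `2d =
2`. -/
theorem Matrix.exists_lift_congr {B : Type*} [CommRing B] (h2 : IsUnit (2 : B)) {I : Ideal B}
    (hI : I ^ 2 = ⊥) {n : ℕ} {q S A : Matrix (Fin n) (Fin n) B} (hq : q.IsSymm) (hS : S.IsSymm)
    (hne : IsUnit q.det) (hdet : S.det = q.det) (hA : Ideal.Quotient.mk I A.det = 1)
    (hAS : (A * q * A.transpose).map (Ideal.Quotient.mk I) = S.map (Ideal.Quotient.mk I)) :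
    ∃ A' : Matrix (Fin n) (Fin n) B, A'.map (Ideal.Quotient.mk I) = A.map (Ideal.Quotient.mk I) ∧
      A'.det = 1 ∧ A' * q * A'.transpose = S := by
  have hsq : ∀ x y : B, Ideal.Quotient.mk I x = 0 → Ideal.Quotient.mk I y = 0 → x * y = 0 := by
    intro x y hx hy
    rw [Ideal.Quotient.eq_zero_iff_mem] at hx hy
    have := Ideal.mul_mem_mul hx hy
    rwa [← pow_two, hI] at this
  have hmat : ∀ M N : Matrix (Fin n) (Fin n) B, M.map (Ideal.Quotient.mk I) = 0 →
      N.map (Ideal.Quotient.mk I) = 0 → M * N = 0 := by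
    intro M N hM hN
    ext i j
    rw [Matrix.mul_apply]
    exact Finset.sum_eq_zero fun l _ ↦ hsq _ _ (congrFun₂ hM i l) (congrFun₂ hN l j)
  have hAunit : IsUnit A.det := by
    have h := hsq (A.det - 1) (A.det - 1) (by simp [hA]) (by simp [hA])
    exact IsUnit.of_mul_eq_one (2 - A.det) (by linear_combination -h)
  obtain ⟨c, hc⟩ := h2.exists_right_inv
  have hqinv : q⁻¹ * q = 1 := Matrix.nonsing_inv_mul _ hne
  let N := S - A * q * A.transpose
  have hNsymm : N.transpose = N := by
    simp only [N, Matrix.transpose_sub, Matrix.transpose_mul, Matrix.transpose_transpose, hS.eq,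
      hq.eq, Matrix.mul_assoc]
  have hN : N.map (Ideal.Quotient.mk I) = 0 := by
    rw [Matrix.map_sub _ (map_sub _), hAS, sub_self]
  let Δ := c • (N * (A⁻¹).transpose * q⁻¹)
  have hΔ : Δ.map (Ideal.Quotient.mk I) = 0 := by
    have : Δ = N * (c • ((A⁻¹).transpose * q⁻¹)) := by
      simp only [Δ, Matrix.mul_smul, Matrix.mul_assoc]
    rw [this, Matrix.map_mul, hN, Matrix.zero_mul]
  have hΔ' : Δ.transpose.map (Ideal.Quotient.mk I) = 0 := by
    rw [Matrix.transpose_map, hΔ, Matrix.transpose_zero]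
  have h₁ : Δ * q * A.transpose = c • N := by
    calc _ = c • (N * ((A⁻¹).transpose * (q⁻¹ * q) * A.transpose)) := by
          simp only [Δ, Matrix.smul_mul, Matrix.mul_assoc]
      _ = c • (N * (A * A⁻¹).transpose) := by
          rw [hqinv, Matrix.mul_one, Matrix.transpose_mul]
      _ = _ := by rw [Matrix.mul_nonsing_inv _ hAunit, Matrix.transpose_one, Matrix.mul_one]
  have h₂ : A * q * Δ.transpose = c • N := by
    have := congrArg Matrix.transpose h₁
    simpa only [Matrix.transpose_mul, Matrix.transpose_smul, Matrix.transpose_transpose, hq.eq,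
      hNsymm, Matrix.mul_assoc] using this
  have h₃ : Δ * q * Δ.transpose = 0 := by
    rw [Matrix.mul_assoc]
    refine hmat _ _ hΔ ?_
    rw [Matrix.map_mul, hΔ', Matrix.mul_zero]
  have hform : (A + Δ) * q * (A + Δ).transpose = S := by
    have : c • N + c • N = N := by
      rw [← add_smul, ← two_mul, hc, one_smul]
    calc _ = A * q * A.transpose + A * q * Δ.transpose + (Δ * q * A.transpose
          + Δ * q * Δ.transpose) := by
          simp only [Matrix.transpose_add, Matrix.add_mul, Matrix.mul_add]
          abel
      _ = A * q * A.transpose + (c • N + c • N) := by rw [h₁, h₂, h₃]; abel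
      _ = S := by rw [this]; simp [N]
  have hmap : (A + Δ).map (Ideal.Quotient.mk I) = A.map (Ideal.Quotient.mk I) := by
    rw [Matrix.map_add _ (map_add _), hΔ, add_zero]
  refine ⟨A + Δ, hmap, ?_, hform⟩
  have hd : Ideal.Quotient.mk I (A + Δ).det = 1 := by
    rw [← hA, RingHom.map_det, RingHom.map_det]
    exact congrArg Matrix.det hmap
  have hd₂ : (A + Δ).det * (A + Δ).det = 1 := by
    have := congrArg Matrix.det hform
    rw [Matrix.det_mul, Matrix.det_mul, Matrix.det_transpose, hdet] at this
    apply hne.mul_right_cancel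
    linear_combination this
  have hd₃ := hsq ((A + Δ).det - 1) ((A + Δ).det - 1) (by simp [hd]) (by simp [hd])
  apply h2.mul_left_cancel
  linear_combination hd₂ - hd₃

/-- A congruence would transport the isotropic vector `(1, √-1, 0, ..., 0)` of the sum of squares to
a nonzero zero of the diagonal form. -/
theorem Matrix.not_exists_congr_of_anisotropic {L : Type*} [Field L] {n : ℕ} (hn : 2 ≤ n)
    (hL : IsSquare (-1 : L)) {D : Fin n → L}
    (hD : ∀ u : Fin n → L, ∑ i, D i * u i ^ 2 = 0 → u = 0) {B C : Matrix (Fin n) (Fin n) L}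
    (hB : B.det ≠ 0) (hC : C.det ≠ 0) :
    B * B.transpose ≠ C * Matrix.diagonal D * C.transpose := by
  intro h
  obtain ⟨r, hr⟩ := hL
  let i₀ : Fin n := ⟨0, by omega⟩
  let i₁ : Fin n := ⟨1, by omega⟩
  have h01 : i₀ ≠ i₁ := by simp [i₀, i₁]
  let w : Fin n → L := Pi.single i₀ 1 + Pi.single i₁ r
  have hw : w ⬝ᵥ w = 0 := by
    simp [w, h01, h01.symm, ← hr]
  have hw0 : w ≠ 0 := fun h ↦ by
    have := congrFun h i₀
    simp [w, h01] at this
  have hB₁ : B⁻¹ * B = 1 := Matrix.nonsing_inv_mul _ hB.isUnit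
  let M := B⁻¹ * C
  have hM : M * Matrix.diagonal D * M.transpose = 1 := by
    calc _ = B⁻¹ * (C * Matrix.diagonal D * C.transpose) * (B⁻¹).transpose := by
          simp only [M, Matrix.transpose_mul, Matrix.mul_assoc]
      _ = (B⁻¹ * B) * (B⁻¹ * B).transpose := by
          rw [← h]
          simp only [Matrix.transpose_mul, Matrix.mul_assoc]
      _ = 1 := by rw [hB₁, Matrix.transpose_one, Matrix.mul_one]
  have hMdet : IsUnit M.transpose.det := by
    rw [Matrix.det_transpose, Matrix.det_mul]
    exact (Matrix.isUnit_nonsing_inv_det _ hB.isUnit).mul hC.isUnit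
  have hu : M.transpose.mulVec w = 0 := by
    apply hD
    calc _ = (M.transpose.mulVec w) ⬝ᵥ (Matrix.diagonal D).mulVec (M.transpose.mulVec w) := by
          simp only [dotProduct, Matrix.mulVec_diagonal]
          exact Finset.sum_congr rfl fun i _ ↦ by ring
      _ = w ⬝ᵥ (M * Matrix.diagonal D * M.transpose).mulVec w := by
          rw [← Matrix.mulVec_mulVec, ← Matrix.mulVec_mulVec, Matrix.dotProduct_mulVec w M,
            ← Matrix.mulVec_transpose]
      _ = 0 := by rw [hM, Matrix.one_mulVec, hw]
  exact hw0 (Matrix.eq_zero_of_mulVec_eq_zero hMdet.ne_zero hu)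

/-- Multiplying by the product of the `X i`, `i ≠ i₀`, turns the coefficients into monomials, with
exponents `0` at `i₀` and `e_i + m` elsewhere. After denominators of `u` are cleared, distinctness
of these exponents modulo 2 forces every numerator to vanish. -/
theorem MvPolynomial.diagonal_anisotropic {E L : Type*} [Field E] [Field L] {n : ℕ} (hn : 3 ≤ n)
    [Algebra (MvPolynomial (Fin n) E) L] [IsFractionRing (MvPolynomial (Fin n) E) L] (i₀ : Fin n)
    {D : Fin n → L}
    (hD₀ : (∏ i ∈ Finset.univ.erase i₀, algebraMap (MvPolynomial (Fin n) E) L (X i)) * D i₀ = 1)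
    (hD : ∀ i ≠ i₀, D i = algebraMap (MvPolynomial (Fin n) E) L (X i)) (u : Fin n → L)
    (hu : ∑ i, D i * u i ^ 2 = 0) : u = 0 := by
  classical
  let s := Finset.univ.erase i₀
  let m : Fin n →₀ ℕ := ∑ i ∈ s, Finsupp.single i 1
  have hm : ∀ i, m i = if i = i₀ then 0 else 1 := by
    intro i
    simp [m, s, Finsupp.finsetSum_apply, Finsupp.single_apply]
  have hprod : (∏ i ∈ s, X i : MvPolynomial (Fin n) E) = monomial m 1 := by
    simp only [m, X, monomial_sum_one]
  let a : Fin n → Fin n →₀ ℕ := fun i ↦ if i = i₀ then 0 else Finsupp.single i 1 + m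
  have ha : ∀ i, algebraMap (MvPolynomial (Fin n) E) L (monomial m 1) * D i =
      algebraMap (MvPolynomial (Fin n) E) L (monomial (a i) 1) := by
    intro i
    by_cases hi : i = i₀
    · subst hi
      rw [← hprod, map_prod, hD₀]
      simp [a]
    · rw [hD i hi, mul_comm, ← map_mul, X, monomial_mul, one_mul]
      simp [a, hi]
  obtain ⟨b, hb⟩ := IsLocalization.exist_integer_multiples (nonZeroDivisors (MvPolynomial (Fin n) E))
    Finset.univ u
  choose p hp using fun i ↦ hb i (Finset.mem_univ i)
  have hb0 : algebraMap (MvPolynomial (Fin n) E) L b ≠ 0 :=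
    IsFractionRing.to_map_ne_zero_of_mem_nonZeroDivisors b.2
  have hp' : ∀ i, algebraMap (MvPolynomial (Fin n) E) L (p i) =
    algebraMap (MvPolynomial (Fin n) E) L b * u i := fun i ↦ by
      rw [hp, Algebra.smul_def]
  have hsum : ∑ i, monomial (a i) 1 * p i ^ 2 = 0 := by
    apply IsFractionRing.injective (MvPolynomial (Fin n) E) L
    rw [map_sum, map_zero]
    calc _ = ∑ i, (algebraMap (MvPolynomial (Fin n) E) L (monomial m 1) *
          algebraMap (MvPolynomial (Fin n) E) L b ^ 2) * (D i * u i ^ 2) := by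
          refine Finset.sum_congr rfl fun i _ ↦ ?_
          rw [map_mul, map_pow, ← ha, hp']
          ring
      _ = 0 := by rw [← Finset.mul_sum, hu, mul_zero]
  have hp0 := MvPolynomial.eq_zero_of_sum_monomial_mul_sq_eq_zero Finset.univ a (by
    rintro i - j - hij
    -- Exponent `0` is told apart from `e_j + m` at an index other than `i₀` and `j`, where the
    -- latter equals 1; this needs `n ≥ 3`.
    have hthird : ∀ i j : Fin n, ∃ x, x ≠ i ∧ x ≠ j := by
      intro i j
      have : ∃ x ∈ (Finset.univ : Finset (Fin n)), x ∉ ({i, j} : Finset (Fin n)) := by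
        apply Finset.exists_mem_notMem_of_card_lt_card
        rw [Finset.card_univ, Fintype.card_fin]
        exact lt_of_le_of_lt Finset.card_le_two hn
      simpa using this
    by_cases hi : i = i₀
    · obtain ⟨x, hx, hx'⟩ := hthird i₀ j
      exact ⟨x, by simp [a, hi, hi ▸ hij.symm, hm, hx, hx'.symm, Nat.ModEq]⟩
    · by_cases hj : j = i₀
      · obtain ⟨x, hx, hx'⟩ := hthird i₀ i
        exact ⟨x, by simp [a, hj, hj ▸ hij, hm, hx, hx'.symm, Nat.ModEq]⟩
      · exact ⟨i, by simp [a, hi, hj, hm, hij.symm, Nat.ModEq]⟩) p hsum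
  ext i
  have := hp' i
  rw [hp0 i (Finset.mem_univ i), map_zero, eq_comm, mul_eq_zero] at this
  exact this.resolve_left hb0

/-! ### Coordinate rings of `SL_n` and of symmetric matrices, and the orbit map between them. -/

section CoordinateRings

open MvPolynomial Matrix

variable {k : Type u} [Field k] {n : ℕ}

/-- The coordinate ring of the affine scheme `matrixScheme E`. -/
abbrev MatrixCoordRing (E : Set (MvPolynomial (Fin n × Fin n) k)) : Type u :=
  MvPolynomial (Fin n × Fin n) k ⧸ Ideal.span E

namespace MatrixCoordRing

variable {E : Set (MvPolynomial (Fin n × Fin n) k)} {R : Type*} [CommRing R]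

/-- The generic matrix satisfying the equations in `E`. -/
def generic (E : Set (MvPolynomial (Fin n × Fin n) k)) :
    Matrix (Fin n) (Fin n) (MatrixCoordRing E) :=
  Matrix.of fun i j ↦ Ideal.Quotient.mk _ (X (i, j))

lemma ringHom_ext {f g : MatrixCoordRing E →+* R}
    (h : f.comp (algebraMap k _) = g.comp (algebraMap k _))
    (h' : (generic E).map f = (generic E).map g) : f = g := by
  apply Ideal.Quotient.ringHom_ext
  ext x
  · exact RingHom.congr_fun h x
  · exact congrFun₂ h' x.1 x.2

lemma eval₂_generic {p : MvPolynomial (Fin n × Fin n) k} (hp : p ∈ E) (f : MatrixCoordRing E →+* R) :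
    p.eval₂ (f.comp (algebraMap k _)) (fun ij ↦ (generic E).map f ij.1 ij.2) = 0 := by
  have h : f.comp (Ideal.Quotient.mk (Ideal.span E)) = eval₂Hom (f.comp (algebraMap k _))
      (fun ij ↦ (generic E).map f ij.1 ij.2) := by
    ext x
    · exact (eval₂_C (f.comp (algebraMap k _)) _ x).symm
    · simp [generic]
  have h' := RingHom.congr_fun h p
  refine h'.symm.trans ?_
  rw [RingHom.comp_apply, Ideal.Quotient.eq_zero_iff_mem.mpr (Ideal.subset_span hp), map_zero]

/-- The homomorphism out of the coordinate ring given by a matrix satisfying the equations. -/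
def lift (φ : k →+* R) (M : Matrix (Fin n) (Fin n) R)
    (h : ∀ p ∈ E, p.eval₂ φ (fun ij ↦ M ij.1 ij.2) = 0) : MatrixCoordRing E →+* R :=
  Ideal.Quotient.lift _ (eval₂Hom φ fun ij ↦ M ij.1 ij.2) fun a ha ↦ by
    have : Ideal.span E ≤ RingHom.ker (eval₂Hom φ fun ij ↦ M ij.1 ij.2) :=
      Ideal.span_le.mpr fun p hp ↦ h p hp
    exact this ha

lemma lift_comp_algebraMap (φ : k →+* R) (M : Matrix (Fin n) (Fin n) R)
    (h : ∀ p ∈ E, p.eval₂ φ (fun ij ↦ M ij.1 ij.2) = 0) : (lift φ M h).comp (algebraMap k _) = φ := by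
  ext x
  exact eval₂_C _ _ x

lemma generic_map_lift (φ : k →+* R) (M : Matrix (Fin n) (Fin n) R)
    (h : ∀ p ∈ E, p.eval₂ φ (fun ij ↦ M ij.1 ij.2) = 0) : (generic E).map (lift φ M h) = M := by
  ext i j
  exact eval₂_X _ _ _

end MatrixCoordRing

/-- The equations for a symmetric matrix of determinant `d`. -/
def symmEquations (n : ℕ) (d : k) : Set (MvPolynomial (Fin n × Fin n) k) :=
  {(univMatrix k n).det - C d} ∪
    Set.range fun ij ↦ (X ij - X ij.swap : MvPolynomial (Fin n × Fin n) k)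

lemma symmEquations_iff {R : Type*} [CommRing R] (φ : k →+* R) (M : Matrix (Fin n) (Fin n) R) (d : k) :
    (∀ p ∈ symmEquations n d, p.eval₂ φ (fun ij ↦ M ij.1 ij.2) = 0) ↔ M.det = φ d ∧ M.IsSymm := by
  have hdet : ((univMatrix k n).det - C d).eval₂ φ (fun ij : Fin n × Fin n ↦ M ij.1 ij.2) =
      M.det - φ d := by
    have := eval₂_det_univMatrix φ M
    simp only [eval₂_sub, eval₂_one, eval₂_C, sub_left_inj] at this ⊢
    exact this
  simp only [symmEquations, Set.union_def, Set.mem_ofPred_eq, Set.mem_singleton_iff,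
    Set.mem_range, or_imp, forall_and, forall_eq, hdet,
    forall_exists_index, forall_apply_eq_imp_iff, eval₂_sub, eval₂_X, sub_eq_zero]
  exact and_congr_right fun _ ↦ ⟨fun h ↦ Matrix.ext fun i j ↦ h (j, i), fun h ij ↦ h.apply ij.2 ij.1⟩

lemma slEquations_iff {R : Type*} [CommRing R] (φ : k →+* R) (M : Matrix (Fin n) (Fin n) R) :
    (∀ p ∈ ({(univMatrix k n).det - 1} : Set (MvPolynomial (Fin n × Fin n) k)),
      p.eval₂ φ (fun ij ↦ M ij.1 ij.2) = 0) ↔ M.det = 1 := by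
  simp only [Set.mem_singleton_iff, forall_eq, eval₂_det_univMatrix, sub_eq_zero]

/-- The coordinate ring of `SL_n`. -/
abbrev SLRing (k : Type u) [Field k] (n : ℕ) : Type u :=
  MatrixCoordRing ({(univMatrix k n).det - 1} : Set (MvPolynomial (Fin n × Fin n) k))

/-- The coordinate ring of the scheme of symmetric matrices of determinant `d`. -/
abbrev SymmRing (n : ℕ) (d : k) : Type u := MatrixCoordRing (symmEquations n d)

lemma SLRing.generic_map_det {R : Type*} [CommRing R] (f : SLRing k n →+* R) :
    ((MatrixCoordRing.generic _).map f).det = 1 :=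
  (slEquations_iff _ _).mp fun _ hp ↦ MatrixCoordRing.eval₂_generic hp f

lemma SymmRing.generic_map {d : k} {R : Type*} [CommRing R] (f : SymmRing n d →+* R) :
    ((MatrixCoordRing.generic _).map f).det = f (algebraMap k _ d) ∧
      ((MatrixCoordRing.generic _).map f).IsSymm :=
  (symmEquations_iff _ _ d).mp fun _ hp ↦ MatrixCoordRing.eval₂_generic hp f

lemma Matrix.IsSymm.congr {R : Type*} [CommRing R] {q : Matrix (Fin n) (Fin n) R} (hq : q.IsSymm)
    (A : Matrix (Fin n) (Fin n) R) : (A * q * Aᵀ).IsSymm := by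
  simp only [Matrix.IsSymm, transpose_mul, transpose_transpose, hq.eq, Matrix.mul_assoc]

/-- The homomorphism on coordinate rings corresponding to `A ↦ A q Aᵀ`, for a symmetric matrix `q`. -/
def congrHom {q : Matrix (Fin n) (Fin n) k} (hq : q.IsSymm) : SymmRing n q.det →+* SLRing k n :=
  MatrixCoordRing.lift (algebraMap k _) (MatrixCoordRing.generic _ * q.map (algebraMap k _) *
    (MatrixCoordRing.generic _)ᵀ) <| (symmEquations_iff _ _ _).mpr ⟨by
      have h : (MatrixCoordRing.generic _ : Matrix (Fin n) (Fin n) (SLRing k n)).det = 1 := by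
        simpa using SLRing.generic_map_det (RingHom.id (SLRing k n))
      rw [det_mul, det_mul, det_transpose, h, one_mul, mul_one, RingHom.map_det]
      rfl, (hq.map _).congr _⟩

lemma congrHom_comp_algebraMap {q : Matrix (Fin n) (Fin n) k} (hq : q.IsSymm) :
    (congrHom hq).comp (algebraMap k _) = algebraMap k _ :=
  MatrixCoordRing.lift_comp_algebraMap _ _ _

lemma generic_map_comp_congrHom {q : Matrix (Fin n) (Fin n) k} (hq : q.IsSymm) {R : Type*} [CommRing R]
    (f : SLRing k n →+* R) :
    (MatrixCoordRing.generic _).map (f.comp (congrHom hq)) =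
      (MatrixCoordRing.generic _).map f * q.map (f.comp (algebraMap k _)) *
        ((MatrixCoordRing.generic _).map f)ᵀ := by
  have h : (MatrixCoordRing.generic _).map (congrHom hq) = MatrixCoordRing.generic _ *
      q.map (algebraMap k (SLRing k n)) * (MatrixCoordRing.generic _)ᵀ :=
    MatrixCoordRing.generic_map_lift _ _ _
  have h' := congrArg (fun M ↦ M.map f) h
  simp only [Matrix.map_map, Matrix.map_mul, Matrix.transpose_map] at h'
  exact h'

/-- In matrix terms, the lifting problem along a square-zero ideal is exactly the one solved by
`Matrix.exists_lift_congr`. -/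
lemma congrHom_formallySmooth (h2 : (2 : k) ≠ 0) {q : Matrix (Fin n) (Fin n) k} (hq : q.IsSymm)
    (hne : IsUnit q.det) : (congrHom hq).FormallySmooth := by
  algebraize [congrHom hq]
  rw [RingHom.FormallySmooth]
  refine Algebra.FormallySmooth.of_comp_surjective fun B _ _ I hI g ↦ ?_
  let φ : k →+* B := (algebraMap (SymmRing n q.det) B).comp (algebraMap k _)
  let S := (MatrixCoordRing.generic _).map (algebraMap (SymmRing n q.det) B)
  obtain ⟨hSdet, hS⟩ := SymmRing.generic_map (algebraMap (SymmRing n q.det) B)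
  have hg : g.toRingHom.comp (congrHom hq) =
      (Ideal.Quotient.mk I).comp (algebraMap (SymmRing n q.det) B) := g.comp_algebraMap
  have hgk : g.toRingHom.comp (algebraMap k _) = (Ideal.Quotient.mk I).comp φ := by
    rw [← congrHom_comp_algebraMap hq, ← RingHom.comp_assoc, hg]
    rfl
  -- The entries are lifted arbitrarily; determinant and congruence hold only modulo `I` at this
  -- stage.
  choose s hs using Ideal.Quotient.mk_surjective (I := I)
  let A : Matrix (Fin n) (Fin n) B := ((MatrixCoordRing.generic _).map g).map s
  have hA : A.map (Ideal.Quotient.mk I) = (MatrixCoordRing.generic _).map g.toRingHom := by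
    ext i j
    exact hs _
  obtain ⟨A', hA'A, hA'det, hA'S⟩ := Matrix.exists_lift_congr (q := q.map φ) (S := S) (A := A) (by
      rw [← map_ofNat φ 2]; exact (isUnit_iff_ne_zero.mpr h2).map φ) hI (hq.map _) hS
    (by rw [← RingHom.mapMatrix_apply, ← RingHom.map_det]; exact hne.map _)
    (by rw [hSdet, ← RingHom.mapMatrix_apply, ← RingHom.map_det]; rfl)
    (by rw [RingHom.map_det, RingHom.mapMatrix_apply, hA]; exact SLRing.generic_map_det _)
    (by
      have h := generic_map_comp_congrHom hq g.toRingHom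
      rw [hg, hgk] at h
      rw [Matrix.map_mul, Matrix.map_mul, Matrix.transpose_map, hA]
      exact h.symm)
  have hA'eq := (slEquations_iff φ A').mpr hA'det
  let f : SLRing k n →+* B := MatrixCoordRing.lift φ A' hA'eq
  have hfk : f.comp (algebraMap k _) = φ := MatrixCoordRing.lift_comp_algebraMap _ _ _
  have hfg : (MatrixCoordRing.generic _).map f = A' := MatrixCoordRing.generic_map_lift _ _ _
  have hf : f.comp (congrHom hq) = algebraMap (SymmRing n q.det) B := by
    apply MatrixCoordRing.ringHom_ext
    · rw [RingHom.comp_assoc, congrHom_comp_algebraMap, hfk]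
    · rw [generic_map_comp_congrHom, hfg, hfk, hA'S]
  refine ⟨{ f with commutes' := RingHom.congr_fun hf }, ?_⟩
  apply AlgHom.coe_ringHom_injective
  apply MatrixCoordRing.ringHom_ext
  · exact (congrArg (RingHom.comp (Ideal.Quotient.mk I)) hfk).trans hgk.symm
  · have h := congrArg (fun M ↦ M.map (Ideal.Quotient.mk I)) hfg
    exact h.trans (hA'A.trans hA)

lemma congrHom_finitePresentation {q : Matrix (Fin n) (Fin n) k} (hq : q.IsSymm) :
    (congrHom hq).FinitePresentation := by
  algebraize [congrHom hq]
  have : IsScalarTower k (SymmRing n q.det) (SLRing k n) :=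
    .of_algebraMap_eq' (congrHom_comp_algebraMap hq).symm
  have : Algebra.FiniteType (SymmRing n q.det) (SLRing k n) := .of_restrictScalars_finiteType k _ _
  exact Algebra.FinitePresentation.of_finiteType.mp this

/-- A prime is the kernel of a map to the algebraic closure of its residue field. There the
corresponding symmetric matrix is congruent to `q` under `SL_n`, and the kernel of the resulting
point of `SL_n` lies above the prime. -/
lemma congrHom_comap_surjective (hn : 0 < n) (h2 : (2 : k) ≠ 0) {q : Matrix (Fin n) (Fin n) k}
    (hq : q.IsSymm) (hne : IsUnit q.det) :
    Function.Surjective (PrimeSpectrum.comap (congrHom hq)) := by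
  intro p
  let K := AlgebraicClosure p.asIdeal.ResidueField
  let f : SymmRing n q.det →+* K := algebraMap _ _
  obtain ⟨hSdet, hS⟩ := SymmRing.generic_map f
  let φ : k →+* K := f.comp (algebraMap k _)
  have hqdet : (q.map φ).det = φ q.det := by rw [RingHom.map_det, RingHom.mapMatrix_apply]
  obtain ⟨A, hA, hAS⟩ := Matrix.exists_congr_of_isAlgClosed (K := K) (by
      rw [← map_ofNat φ 2]; exact (map_ne_zero φ).mpr h2) hn (hq.map φ) hS
    (by rw [hSdet, hqdet]; rfl)
    (by rw [hqdet]; exact (hne.map φ).ne_zero)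
  let g : SLRing k n →+* K := MatrixCoordRing.lift φ A ((slEquations_iff _ _).mpr hA)
  have hgk : g.comp (algebraMap k _) = φ := MatrixCoordRing.lift_comp_algebraMap _ _ _
  have hgg : (MatrixCoordRing.generic _).map g = A := MatrixCoordRing.generic_map_lift _ _ _
  have hg : g.comp (congrHom hq) = f := by
    apply MatrixCoordRing.ringHom_ext
    · rw [RingHom.comp_assoc, congrHom_comp_algebraMap, hgk]
    · rw [generic_map_comp_congrHom, hgg, hgk, hAS]
  refine ⟨PrimeSpectrum.comap g ⊥, ?_⟩
  rw [← PrimeSpectrum.comap_comp_apply, hg]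
  ext x
  change f x = 0 ↔ _
  rw [show f x = algebraMap p.asIdeal.ResidueField K (algebraMap _ _ x) from rfl, map_eq_zero,
    Ideal.algebraMap_residueField_eq_zero]

lemma congrHom_faithfullyFlat (hn : 0 < n) (h2 : (2 : k) ≠ 0) {q : Matrix (Fin n) (Fin n) k}
    (hq : q.IsSymm) (hne : IsUnit q.det) : (congrHom hq).FaithfullyFlat := by
  rw [RingHom.FaithfullyFlat.iff_flat_and_comap_surjective]
  refine ⟨RingHom.Smooth.flat ?_, congrHom_comap_surjective hn h2 hq hne⟩
  exact RingHom.smooth_def.mpr ⟨congrHom_formallySmooth h2 hq hne, congrHom_finitePresentation hq⟩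

/-- The ring is a retract of the domain `k[X_ij][1/det]`: dividing row 0 of an invertible matrix by
its determinant retracts `GL_n` onto `SL_n`. -/
instance SLRing.isDomain [NeZero n] : IsDomain (SLRing k n) := by
  let P := MvPolynomial (Fin n × Fin n) k
  let d : P := (univMatrix k n).det
  have hd : d ≠ 0 := by
    exact det_mvPolynomialX_ne_zero _ _
  let A := Localization.Away d
  have : IsDomain A := IsLocalization.isDomain_localization
    (powers_le_nonZeroDivisors_of_noZeroDivisors hd)
  let u : A := IsLocalization.Away.invSelf d
  have hu : algebraMap P A d * u = 1 := IsLocalization.Away.mul_invSelf d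
  let M : Matrix (Fin n) (Fin n) A := ((univMatrix k n).map (algebraMap P A)).updateRow 0
    (u • fun j ↦ algebraMap P A (X (0, j)))
  have hM : M.det = 1 := by
    have h : (fun j ↦ algebraMap P A (X (0, j))) = (univMatrix k n).map (algebraMap P A) 0 := rfl
    rw [det_updateRow_smul, h, updateRow_eq_self, ← RingHom.mapMatrix_apply, ← RingHom.map_det,
      mul_comm, hu]
  let f : SLRing k n →+* A := MatrixCoordRing.lift (algebraMap k A) M ((slEquations_iff _ _).mpr hM)
  let g₀ : P →+* SLRing k n := Ideal.Quotient.mk _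
  have hg₀ : g₀ d = 1 :=
    (RingHom.map_det g₀ _).trans (SLRing.generic_map_det (RingHom.id (SLRing k n)))
  let g : A →+* SLRing k n := IsLocalization.Away.lift d (g := g₀) (by rw [hg₀]; exact isUnit_one)
  have hgP : g.comp (algebraMap P A) = g₀ := IsLocalization.Away.lift_comp d _
  have hgP' (x : P) : g (algebraMap P A x) = g₀ x := RingHom.congr_fun hgP x
  have hgu : g u = 1 := by
    have h := congrArg g hu
    rwa [map_mul, hgP', hg₀, one_mul, map_one] at h
  have hgf : g.comp f = RingHom.id _ := by
    apply MatrixCoordRing.ringHom_ext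
    · rw [RingHom.comp_assoc, MatrixCoordRing.lift_comp_algebraMap, IsScalarTower.algebraMap_eq k P A,
        ← RingHom.comp_assoc, hgP]
      rfl
    · have hfM : (MatrixCoordRing.generic _).map f = M := MatrixCoordRing.generic_map_lift _ _ _
      refine (congrArg (fun N ↦ N.map g) hfM).trans ?_
      ext i j
      by_cases hi : i = 0
      · subst hi
        have : g (u * algebraMap P A (X (0, j))) = MatrixCoordRing.generic _ 0 j := by
          rw [map_mul, hgu, one_mul, hgP']
          rfl
        simpa [M] using this
      · have : g (algebraMap P A (X (i, j))) = MatrixCoordRing.generic _ i j := hgP' _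
        simpa [M, hi] using this
  have hf : Function.Injective f := by
    apply Function.LeftInverse.injective (g := g)
    exact RingHom.congr_fun hgf
  exact hf.isDomain f
-- A field-valued point over the generic point that does not lift to `SL_n`.
-- Injectivity of `ψ` says that the point lies over the generic point. The point is `S = g P D Pᵀ
-- gᵀ`, with `g` the generic matrix of `SL_n`, `q = P Pᵀ` and `D` the anisotropic diagonal matrix. A
-- lift `B` would give `(B P)(B P)ᵀ = (g P) D (g P)ᵀ`.
theorem exists_injective_not_comp_congrHom (hn : 3 ≤ n) (h2 : (2 : k) ≠ 0)
    {q : Matrix (Fin n) (Fin n) k} (hq : q.IsSymm) (hne : IsUnit q.det) :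
    ∃ (L : Type u) (_ : Field L) (ψ : SymmRing n q.det →+* L), Function.Injective ψ ∧
      ∀ χ : SLRing k n →+* L, χ.comp (congrHom hq) ≠ ψ := by
  have : NeZero n := ⟨by omega⟩
  let E := AlgebraicClosure (FractionRing (SLRing k n))
  let θ : SLRing k n →+* E := (algebraMap (FractionRing (SLRing k n)) E).comp (algebraMap _ _)
  have hθ : Function.Injective θ :=
    (algebraMap (FractionRing (SLRing k n)) E).injective.comp (IsFractionRing.injective _ _)
  let φ : k →+* E := θ.comp (algebraMap k _)
  let g : Matrix (Fin n) (Fin n) E := (MatrixCoordRing.generic _).map θ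
  have hg : g.det = 1 := SLRing.generic_map_det θ
  obtain ⟨P, hP⟩ := Matrix.exists_eq_mul_transpose (S := q.map φ)
    (by rw [← map_ofNat φ 2]; exact (map_ne_zero φ).mpr h2) (hq.map φ)
  have hPdet : P.det * P.det = φ q.det := by
    rw [RingHom.map_det, RingHom.mapMatrix_apply, hP, det_mul, det_transpose]
  have hPne : P.det ≠ 0 := fun h ↦ (hne.map φ).ne_zero (by rw [← hPdet, h, zero_mul])
  let R := MvPolynomial (Fin n) E
  let p : R := ∏ i ∈ Finset.univ.erase 0, X i
  have hp : p ≠ 0 := Finset.prod_ne_zero_iff.mpr fun i _ ↦ X_ne_zero i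
  -- The matrix `D` is defined over this ring, which unlike its fraction field still admits
  -- evaluation at `x_i = 1`.
  let A := Localization.Away p
  let v : A := IsLocalization.Away.invSelf p
  have hv : algebraMap R A p * v = 1 := IsLocalization.Away.mul_invSelf p
  let L := FractionRing R
  let j : A →+* L := IsLocalization.Away.lift p (g := algebraMap R L)
    (isUnit_iff_ne_zero.mpr (by simpa using hp))
  have hj : j.comp (algebraMap R A) = algebraMap R L := IsLocalization.Away.lift_comp p _
  have hj_inj : Function.Injective j := by
    algebraize [j]
    have : IsScalarTower R A L := .of_algebraMap_eq' hj.symm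
    have : IsFractionRing A L :=
      IsFractionRing.isFractionRing_of_isDomain_of_isLocalization (Submonoid.powers p) A L
    exact IsFractionRing.injective A L
  let c : E →+* A := (algebraMap R A).comp C
  -- The entry at 0 is the inverse of the product of the others, so that `det D = 1`; the variable
  -- `X 0` does not occur in `D`.
  let D : Fin n → A := Function.update (fun i ↦ algebraMap R A (X i)) 0 v
  have hDdet : (diagonal D).det = 1 := by
    rw [det_diagonal, Finset.prod_update_of_mem (Finset.mem_univ _), ← hv, mul_comm, map_prod]
    congr 2
    ext i
    simp
  let T : Matrix (Fin n) (Fin n) A := (g * P).map c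
  have hTdet : T.det = c P.det := by
    change (c.mapMatrix (g * P)).det = _
    rw [← RingHom.map_det, det_mul, hg, one_mul]
  have hS := (symmEquations_iff (c.comp φ) (T * diagonal D * Tᵀ) q.det).mpr ⟨by
    rw [det_mul, det_mul, det_transpose, hDdet, mul_one, hTdet, ← map_mul, hPdet]
    rfl, (isSymm_diagonal D).congr T⟩
  let ψ : SymmRing n q.det →+* A := MatrixCoordRing.lift (c.comp φ) _ hS
  have hψk : ψ.comp (algebraMap k _) = c.comp φ := MatrixCoordRing.lift_comp_algebraMap _ _ _
  have hψ : (MatrixCoordRing.generic _).map ψ = T * diagonal D * Tᵀ :=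
    MatrixCoordRing.generic_map_lift _ _ _
  have hp₁ : eval (fun _ ↦ (1 : E)) p = 1 := by
    simp only [p, map_prod, eval_X, Finset.prod_const_one]
  let ev : A →+* E := IsLocalization.Away.lift p (g := eval fun _ ↦ (1 : E))
    (by rw [hp₁]; exact isUnit_one)
  have hev (x : R) : ev (algebraMap R A x) = eval (fun _ ↦ (1 : E)) x :=
    IsLocalization.Away.lift_eq p _ x
  have hevc (x : E) : ev (c x) = x := (hev _).trans (eval_C x)
  have hevv : ev v = 1 := by
    have h := congrArg ev hv
    rwa [map_mul, hev, map_one, hp₁, one_mul] at h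
  have hevD : (diagonal D).map ev = 1 := by
    rw [diagonal_map (map_zero ev), ← diagonal_one]
    congr 1
    ext i
    by_cases hi : i = 0
    · subst hi
      simp [D, hevv]
    · simpa [D, hi] using (hev (X i)).trans (eval_X i)
  have hevT : T.map ev = g * P := by
    ext i j
    exact hevc _
  -- At `x_i = 1` the matrix `D` becomes the identity and `S` becomes `g q gᵀ`. The right-hand side
  -- is injective, hence so is `ψ`.
  have hevψ : ev.comp ψ = θ.comp (congrHom hq) := by
    apply MatrixCoordRing.ringHom_ext
    · rw [RingHom.comp_assoc, hψk, RingHom.comp_assoc (algebraMap k _) (congrHom hq) θ,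
        congrHom_comp_algebraMap]
      ext x
      exact hevc _
    · rw [generic_map_comp_congrHom]
      refine (congrArg (fun M ↦ M.map ev) hψ).trans ?_
      change _ = g * q.map φ * gᵀ
      rw [Matrix.map_mul, Matrix.map_mul, Matrix.transpose_map, hevT, hevD, hP]
      simp only [transpose_mul, Matrix.mul_assoc, Matrix.one_mul]
  have hψ_inj : Function.Injective ψ := by
    apply Function.Injective.of_comp (f := ev)
    change Function.Injective (ev.comp ψ)
    rw [hevψ]
    exact hθ.comp (congrHom_faithfullyFlat (by omega) h2 hq hne).injective
  refine ⟨L, inferInstance, j.comp ψ, hj_inj.comp hψ_inj, fun χ hχ ↦ ?_⟩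
  have hχk : χ.comp (algebraMap k _) = (j.comp c).comp φ := by
    rw [← congrHom_comp_algebraMap hq, ← RingHom.comp_assoc, hχ, RingHom.comp_assoc, hψk]
    rfl
  have h := generic_map_comp_congrHom hq χ
  rw [hχ, hχk] at h
  have hχdet := SLRing.generic_map_det χ
  set B := (MatrixCoordRing.generic _).map χ
  have hq' : q.map ((j.comp c).comp φ) = P.map (j.comp c) * (P.map (j.comp c))ᵀ := by
    rw [← Matrix.transpose_map, ← Matrix.map_mul, ← hP]
    rfl
  have hPdet' : (P.map (j.comp c)).det ≠ 0 := by
    rw [← RingHom.mapMatrix_apply, ← RingHom.map_det]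
    exact (map_ne_zero _).mpr hPne
  refine Matrix.not_exists_congr_of_anisotropic (L := L) (by omega : 2 ≤ n) (D := j ∘ D)
    (B := B * P.map (j.comp c)) (C := T.map j) ?_ ?_ ?_ ?_ ?_
  · obtain ⟨r, hr⟩ := IsAlgClosed.exists_eq_mul_self (-1 : E)
    exact ⟨j (c r), by rw [← map_mul, ← map_mul, ← hr]; simp⟩
  · refine fun u hu ↦ MvPolynomial.diagonal_anisotropic (E := E) hn 0 ?_ ?_ u hu
    · have := congrArg j hv
      rw [map_mul, map_one, ← RingHom.comp_apply, hj] at this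
      have hD₀ : D 0 = v := Function.update_self _ _ _
      rw [← map_prod, Function.comp_apply, hD₀]
      exact this
    · intro i hi
      rw [← hj]
      simp [D, hi]
  · rw [det_mul, hχdet, one_mul]
    exact hPdet'
  · rw [← RingHom.mapMatrix_apply, ← RingHom.map_det, hTdet]
    exact (map_ne_zero (j.comp c)).mpr hPne
  · have h' : (MatrixCoordRing.generic _).map (j.comp ψ) = (T * diagonal D * Tᵀ).map j :=
      congrArg (fun M ↦ M.map j) hψ
    rw [h', hq', Matrix.map_mul, Matrix.map_mul, Matrix.transpose_map, diagonal_map (map_zero j)] at h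
    rw [transpose_mul]
    simpa only [Matrix.mul_assoc, Function.comp_def] using h.symm

end CoordinateRings

/-! ### Sections of trivial torsors, generic points, and uniqueness of quotients. -/

lemma GTorsor.exists_section_of_res_eq_triv {B : Scheme.{u}} {G : Over B} [GrpObj G] [Flat G.hom]
    [LocallyOfFinitePresentation G.hom] {S S' : Over B} (P : GTorsor G S) (f : S' ⟶ S)
    (h : H1.res f P.cls = H1.triv G S') : ∃ s : S' ⟶ P.obj, s ≫ P.proj = f := by
  obtain ⟨(e : pullback P.proj f ≅ S' ⊗ G), (he : e.hom ≫ fst S' G = pullback.snd P.proj f), -⟩ :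
    (P.baseChange f).IsIsomorphic (trivial G S') := Quotient.exact h
  have he' : e.inv ≫ pullback.snd P.proj f = fst S' G := by
    rw [Iso.inv_comp_eq, he]
  -- The unit section of the trivial torsor, carried over to the base change of `P` and projected to
  -- `P`.
  refine ⟨lift (𝟙 S') (toUnit S' ≫ η[G]) ≫ e.inv ≫ pullback.fst P.proj f, ?_⟩
  have h₁ : (lift (𝟙 S') (toUnit S' ≫ η[G]) ≫ e.inv ≫ pullback.fst P.proj f) ≫ P.proj =
      lift (𝟙 S') (toUnit S' ≫ η[G]) ≫ (e.inv ≫ pullback.snd P.proj f) ≫ f := by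
    rw [Category.assoc, Category.assoc, Category.assoc, pullback.condition]
  rw [h₁, he', lift_fst_assoc, Category.id_comp]

lemma GTorsor.IsZariskiLocallyTrivial.exists_generic_section {B : Scheme.{u}} {G : Over B} [GrpObj G]
    [Flat G.hom] [LocallyOfFinitePresentation G.hom] {S : Over B} [IsIntegral S.left]
    {P : GTorsor G S} (h : P.IsZariskiLocallyTrivial) :
    ∃ s : Spec S.left.functionField ⟶ P.obj.left,
      s ≫ P.proj.left = S.left.fromSpecStalk (genericPoint S.left) := by
  obtain ⟨U, hU, hres⟩ := h (genericPoint S.left)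
  obtain ⟨s, hs⟩ := P.exists_section_of_res_eq_triv _ hres
  refine ⟨U.fromSpecStalkOfMem (genericPoint S.left) hU ≫ s.left, ?_⟩
  rw [Category.assoc, ← Over.comp_left, hs]
  exact Scheme.Opens.fromSpecStalkOfMem_ι _ _ _

lemma Spec_map_closedPoint_eq_genericPoint {R L : Type u} [CommRing R] [IsDomain R] [Field L]
    {ψ : R →+* L} (hψ : Function.Injective ψ) :
    Spec.map (CommRingCat.ofHom ψ) (IsLocalRing.closedPoint (CommRingCat.of L)) =
      genericPoint (Spec (CommRingCat.of R)) := by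
  refine Eq.trans ?_ (genericPoint_eq_bot_of_affine (CommRingCat.of R)).symm
  apply PrimeSpectrum.ext
  change Ideal.comap ψ (IsLocalRing.maximalIdeal L) = ⊥
  rw [IsLocalRing.maximalIdeal_eq_bot]
  exact (RingHom.injective_iff_ker_eq_bot ψ).mp hψ

lemma exists_comp_fromSpecStalk_eq {X : Scheme.{u}} {R : CommRingCat.{u}} [IsLocalRing R]
    {f : Spec R ⟶ X} {x : X} (hx : f (IsLocalRing.closedPoint R) = x) :
    ∃ c : Spec R ⟶ Spec (X.presheaf.stalk x), c ≫ X.fromSpecStalk x = f := by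
  subst hx
  exact ⟨_, Scheme.Spec_stalkClosedPointTo_fromSpecStalk f⟩

/-- Both projections are regular epimorphisms, being faithfully flat and locally of finite
presentation, and both have the kernel pair `G × H ⇉ G`. Each therefore factors through the other.
-/
lemma IsGroupQuotient.exists_iso {B : Scheme.{u}} {H G : Over B} [GrpObj H] [GrpObj G] {i : H ⟶ G}
    [IsMonHom i] {X X' : Over B} {π : G ⟶ X} {π' : G ⟶ X'} (h : IsGroupQuotient i π)
    (h' : IsGroupQuotient i π') : ∃ e : X.left ≅ X'.left, π.left ≫ e.hom = π'.left := by
  have := h.flat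
  have := h.surjective
  have := h.locallyOfFinitePresentation
  have := h'.flat
  have := h'.surjective
  have := h'.locallyOfFinitePresentation
  have hp := h.isPullback.map (Over.forget B)
  have hp' := h'.isPullback.map (Over.forget B)
  obtain ⟨f, hf⟩ := IsRegularEpi.exists_of_isKernelPair π.left hp π'.left hp'.w
  obtain ⟨g, hg⟩ := IsRegularEpi.exists_of_isKernelPair π'.left hp' π.left hp.w
  refine ⟨⟨f, g, ?_, ?_⟩, hf⟩
  · rw [← cancel_epi π.left, reassoc_of% hf, hg, Category.comp_id]
  · rw [← cancel_epi π'.left, reassoc_of% hg, hf, Category.comp_id]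

/-! ### The orbit map as a quotient by `SO(Q)`, and its generic fibre. -/

section QuotientMap

open MvPolynomial Matrix

variable {k : Type u} [Field k] {n : ℕ}

/-- The scheme of symmetric `n × n` matrices of determinant `d`. -/
def SymmScheme (n : ℕ) (d : k) : Over (Spec (CommRingCat.of k)) := matrixScheme (symmEquations n d)

/-- The morphism `A ↦ A q Aᵀ` from `SL_n` to the scheme of symmetric matrices of determinant `det q`. -/
def congrMap {q : Matrix (Fin n) (Fin n) k} (hq : q.IsSymm) : SLScheme k n ⟶ SymmScheme n q.det :=
  Over.homMk (Spec.map (CommRingCat.ofHom (congrHom hq))) (by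
    change Spec.map _ ≫ Spec.map _ = Spec.map _
    rw [← Spec.map_comp, ← CommRingCat.ofHom_comp, congrHom_comp_algebraMap])

lemma matrix_comp_congrMap {q : Matrix (Fin n) (Fin n) k} (hq : q.IsSymm)
    {T : Over (Spec (CommRingCat.of k))} (f : T ⟶ SLScheme k n) :
    (matrixSchemeHomEquiv (symmEquations n q.det) T (f ≫ congrMap hq)).1 =
      (SLPoints k n T f).1 * q.map (structureHom T) * (SLPoints k n T f).1ᵀ := by
  let F := overSpecHomEquiv (SLRing k n) T f
  have h₁ : (overSpecHomEquiv (SymmRing n q.det) T (f ≫ congrMap hq)).1 = F.1.comp (congrHom hq) := by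
    have := Scheme.ΓSpecIso_inv_naturality (CommRingCat.ofHom (congrHom hq))
    have h := congrArg (fun g ↦ (g ≫ f.left.appTop).hom) this
    have h₂ : (f ≫ congrMap hq).left.appTop =
      (Spec.map (CommRingCat.ofHom (congrHom hq))).appTop ≫ f.left.appTop := by
        rw [Over.comp_left, Scheme.Hom.comp_appTop]
        rfl
    simp only [overSpecHomEquiv, Equiv.coe_fn_mk, F]
    exact h.symm
  have h₂ := generic_map_comp_congrHom hq F.1
  rw [F.2, ← h₁] at h₂
  exact h₂

lemma comp_congrMap_eq_iff {q : Matrix (Fin n) (Fin n) k} (hq : q.IsSymm)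
    {T : Over (Spec (CommRingCat.of k))} (f g : T ⟶ SLScheme k n) :
    f ≫ congrMap hq = g ≫ congrMap hq ↔
      (SLPoints k n T f).1 * q.map (structureHom T) * (SLPoints k n T f).1ᵀ =
        (SLPoints k n T g).1 * q.map (structureHom T) * (SLPoints k n T g).1ᵀ := by
  rw [← matrix_comp_congrMap hq, ← matrix_comp_congrMap hq, Subtype.val_inj,
    EmbeddingLike.apply_eq_iff_eq]
  exact Iff.rfl

/-- This identifies `SO(Q)` with the stabiliser of `q = Q⁻¹` under `M ↦ M q Mᵀ`. Passing to the
inverse form is what makes the orbit map invariant under right multiplication. -/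
lemma Matrix.transpose_mul_mul_eq_iff {R : Type*} [CommRing R] {Q q : Matrix (Fin n) (Fin n) R}
    (h : Q * q = 1) (M : Matrix (Fin n) (Fin n) R) : Mᵀ * Q * M = Q ↔ M * q * Mᵀ = q := by
  have h' : q * Q = 1 := mul_eq_one_comm.mp h
  constructor
  · intro hM
    have h₁ : Mᵀ * (Q * M * q) = 1 := by
      rw [← Matrix.mul_assoc, ← Matrix.mul_assoc, hM, h]
    have h₂ := mul_eq_one_comm.mp h₁
    calc M * q * Mᵀ = (q * Q) * M * q * Mᵀ := by rw [h', Matrix.one_mul]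
      _ = q * (Q * M * q * Mᵀ) := by simp only [Matrix.mul_assoc]
      _ = q := by rw [h₂, Matrix.mul_one]
  · intro hM
    have h₁ : M * (q * Mᵀ * Q) = 1 := by
      rw [← h', ← Matrix.mul_assoc, ← Matrix.mul_assoc, hM]
    have h₂ := mul_eq_one_comm.mp h₁
    calc Mᵀ * Q * M = (Q * q) * Mᵀ * Q * M := by rw [h, Matrix.one_mul]
      _ = Q * (q * Mᵀ * Q * M) := by simp only [Matrix.mul_assoc]
      _ = Q := by rw [h₂, Matrix.mul_one]

lemma SOSubgroup.congr_mul {R : Type*} [CommRing R] {φ : k →+* R} {Q q : Matrix (Fin n) (Fin n) k}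
    (h : Q * q = 1) (M : SpecialLinearGroup (Fin n) R) {N : SpecialLinearGroup (Fin n) R}
    (hN : N ∈ SOSubgroup φ Q) : (M * N).1 * q.map φ * (M * N).1ᵀ = M.1 * q.map φ * M.1ᵀ := by
  have h' : Q.map φ * q.map φ = 1 := by
    rw [← Matrix.map_mul, h, Matrix.map_one _ (map_zero _) (map_one _)]
  have h₁ := (Matrix.transpose_mul_mul_eq_iff h' _).mp hN
  have h₂ : (M * N).1 = M.1 * N.1 := Matrix.SpecialLinearGroup.coe_mul M N
  rw [h₂, transpose_mul]
  calc _ = M.1 * (N.1 * q.map φ * N.1ᵀ) * M.1ᵀ := by simp only [Matrix.mul_assoc]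
    _ = _ := by rw [h₁]

lemma SOSubgroup.inv_mul_mem {R : Type*} [CommRing R] {φ : k →+* R} {Q q : Matrix (Fin n) (Fin n) k}
    (h : Q * q = 1) {M N : SpecialLinearGroup (Fin n) R}
    (hMN : M.1 * q.map φ * M.1ᵀ = N.1 * q.map φ * N.1ᵀ) : M⁻¹ * N ∈ SOSubgroup φ Q := by
  have h' : Q.map φ * q.map φ = 1 := by
    rw [← Matrix.map_mul, h, Matrix.map_one _ (map_zero _) (map_one _)]
  refine (Matrix.transpose_mul_mul_eq_iff h' _).mpr ?_
  have h₁ : M⁻¹.1 * M.1 = 1 := congrArg Subtype.val (inv_mul_cancel M)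
  have h₂ : (M⁻¹ * N).1 = M⁻¹.1 * N.1 := Matrix.SpecialLinearGroup.coe_mul _ _
  rw [h₂, transpose_mul]
  calc _ = M⁻¹.1 * (N.1 * q.map φ * N.1ᵀ) * M⁻¹.1ᵀ := by simp only [Matrix.mul_assoc]
    _ = (M⁻¹.1 * M.1) * q.map φ * (M⁻¹.1 * M.1)ᵀ := by
      rw [← hMN]
      simp only [transpose_mul, Matrix.mul_assoc]
    _ = _ := by rw [h₁, transpose_one, Matrix.one_mul, Matrix.mul_one]

lemma SLPoints_lift_mul (Q : Matrix (Fin n) (Fin n) k) {T : Over (Spec (CommRingCat.of k))}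
    (a : T ⟶ SLScheme k n) (g : T ⟶ SOScheme Q) :
    SLPoints k n T (lift a g ≫ (SLScheme k n ◁ SOIncl Q) ≫ μ[SLScheme k n]) =
      SLPoints k n T a * (SOPoints Q T g).1 := by
  have : lift a g ≫ (SLScheme k n ◁ SOIncl Q) ≫ μ[SLScheme k n] = a * (g ≫ SOIncl Q) := by
    rw [Hom.mul_def, lift_whiskerLeft_assoc]
  rw [this, map_mul, SLPoints_comp_SOIncl]

/-- On `T`-points, `M` and `N` have the same image exactly when `M⁻¹ N` stabilises `q`, so simple
transitivity on the fibres is matrix algebra. The remaining conditions come from the coordinate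
rings. -/
theorem congrMap_isGroupQuotient (hn : 0 < n) (h2 : (2 : k) ≠ 0) {Q q : Matrix (Fin n) (Fin n) k}
    (hq : q.IsSymm) (hQq : Q * q = 1) : IsGroupQuotient (SOIncl Q) (congrMap hq) := by
  have hne : IsUnit q.det := IsUnit.of_mul_eq_one_right Q.det (by rw [← det_mul, hQq, det_one])
  have hff := congrHom_faithfullyFlat hn h2 hq hne
  refine ⟨Flat.SpecMap_iff.mpr hff.flat, ?_, ?_, ?_⟩
  · exact ((flat_and_surjective_SpecMap_iff (CommRingCat.ofHom (congrHom hq))).mpr hff).2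
  · change LocallyOfFinitePresentation (Spec.map _)
    rw [LocallyOfFinitePresentation.SpecMap_iff]
    exact congrHom_finitePresentation hq
  apply GTorsor.isPullback_of_existsUnique
  · rw [← Category.id_comp ((SLScheme k n ◁ SOIncl Q) ≫ μ[SLScheme k n]), ← lift_fst_snd,
      comp_congrMap_eq_iff, SLPoints_lift_mul]
    exact SOSubgroup.congr_mul hQq _ (SOPoints Q _ (snd (SLScheme k n) (SOScheme Q))).2
  · intro T a b hab
    have hmem := SOSubgroup.inv_mul_mem hQq ((comp_congrMap_eq_iff hq a b).mp hab)
    refine ⟨(SOPoints Q T).symm ⟨_, hmem⟩, ?_, ?_⟩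
    · apply (SLPoints k n T).injective
      rw [SLPoints_lift_mul, MulEquiv.apply_symm_apply, mul_inv_cancel_left]
    · intro g hg
      apply (SOPoints Q T).injective
      rw [MulEquiv.apply_symm_apply]
      have h := SLPoints_lift_mul Q a g
      rw [hg] at h
      exact Subtype.ext (eq_inv_mul_of_mul_eq h.symm)

lemma SymmRing.isDomain (hn : 0 < n) (h2 : (2 : k) ≠ 0) {q : Matrix (Fin n) (Fin n) k} (hq : q.IsSymm)
    (hne : IsUnit q.det) : IsDomain (SymmRing n q.det) :=
  have : NeZero n := ⟨hn.ne'⟩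
  (congrHom_faithfullyFlat hn h2 hq hne).injective.isDomain _

theorem IsGroupQuotient.isIntegral (hn : 0 < n) (h2 : (2 : k) ≠ 0) {Q : Matrix (Fin n) (Fin n) k}
    (hQ : Q.IsSymm) (hQdet : IsUnit Q.det) {X : Over (Spec (CommRingCat.of k))}
    {π : SLScheme k n ⟶ X} (h : IsGroupQuotient (SOIncl Q) π) : IsIntegral X.left := by
  have hQq : Q * Q⁻¹ = 1 := Matrix.mul_nonsing_inv _ hQdet
  have hne : IsUnit Q⁻¹.det := Matrix.isUnit_nonsing_inv_det _ hQdet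
  obtain ⟨e, -⟩ := (congrMap_isGroupQuotient hn h2 hQ.inv hQq).exists_iso h
  have := SymmRing.isDomain hn h2 hQ.inv hne
  have : IsIntegral (Spec (CommRingCat.of (SymmRing n Q⁻¹.det))) := inferInstance
  have : IsIntegral (SymmScheme n Q⁻¹.det).left := this
  have : Nonempty X.left := ⟨e.hom (Nonempty.some inferInstance)⟩
  exact isIntegral_of_isOpenImmersion e.inv

/-- The exceptional point `Spec L ⟶ X` hits the generic point, so it factors through the spectrum of
the function field. Composing with a section would lift it to `SL_n`. -/
theorem IsGroupQuotient.not_exists_generic_section (hn : 3 ≤ n) (h2 : (2 : k) ≠ 0)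
    {Q : Matrix (Fin n) (Fin n) k} (hQ : Q.IsSymm) (hQdet : IsUnit Q.det)
    {X : Over (Spec (CommRingCat.of k))} [IsIntegral X.left]
    {π : SLScheme k n ⟶ X} (h : IsGroupQuotient (SOIncl Q) π) :
    ¬ ∃ s : Spec X.left.functionField ⟶ (SLScheme k n).left,
      s ≫ π.left = X.left.fromSpecStalk (genericPoint X.left) := by
  rintro ⟨s, hs⟩
  have hQq : Q * Q⁻¹ = 1 := Matrix.mul_nonsing_inv _ hQdet
  have hne : IsUnit Q⁻¹.det := Matrix.isUnit_nonsing_inv_det _ hQdet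
  obtain ⟨e, he⟩ := (congrMap_isGroupQuotient (by omega) h2 hQ.inv hQq).exists_iso h
  have := SymmRing.isDomain (by omega) h2 hQ.inv hne
  obtain ⟨L, _, ψ, hψ, hχ⟩ := exists_injective_not_comp_congrHom hn h2 hQ.inv hne
  have : IsIntegral (SymmScheme n Q⁻¹.det).left :=
    inferInstanceAs (IsIntegral (Spec (CommRingCat.of (SymmRing n Q⁻¹.det))))
  let p : Spec (CommRingCat.of L) ⟶ (SymmScheme n Q⁻¹.det).left := Spec.map (CommRingCat.ofHom ψ)
  have hgen : (p ≫ e.hom) (IsLocalRing.closedPoint (CommRingCat.of L)) = genericPoint X.left := by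
    rw [← genericPoint_eq_of_isOpenImmersion e.hom]
    exact congrArg e.hom (Spec_map_closedPoint_eq_genericPoint hψ)
  have hfac := exists_comp_fromSpecStalk_eq hgen
  obtain ⟨c, hc⟩ := hfac
  have hlift : (c ≫ s) ≫ (congrMap hQ.inv).left = p := by
    rw [← cancel_mono e.hom, Category.assoc, Category.assoc, he, hs, hc]
  obtain ⟨χ, hχ'⟩ := Spec.map_surjective (R := CommRingCat.of (SLRing k n)) (c ≫ s)
  apply hχ χ.hom
  have h₃ : Spec.map χ ≫ Spec.map (CommRingCat.ofHom (congrHom hQ.inv)) =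
      Spec.map (CommRingCat.ofHom ψ) := by
    rw [hχ']
    exact hlift
  rw [← Spec.map_comp] at h₃
  exact congrArg CommRingCat.Hom.hom (Spec.map_injective h₃)

end QuotientMap

end

/-- If `Q` is an invertible symmetric `n × n` matrix over `k`, with `n ≥ 3` and `char k ≠ 2`, then the
quotient `SL_n / SO(Q)` exists, and for every such quotient `π : SL_n ⟶ X` the `SO(Q)`-torsor `π` is
not Zariski-locally trivial, `X` is integral, and for `K` the function field of `X` the class of
the generic fibre of `π` in `H¹(K, SO(Q))` is nontrivial. -/
theorem mainTheorem3 {k : Type*} [Field k] (hk : ringChar k ≠ 2) {n : ℕ} (hn : 3 ≤ n)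
    (Q : Matrix (Fin n) (Fin n) k) (hQ : Q.IsSymm) (hQdet : IsUnit Q.det) :
    (∃ (X : CategoryTheory.Over (AlgebraicGeometry.Spec (CommRingCat.of k)))
      (π : SLScheme k n ⟶ X), IsGroupQuotient (SOIncl Q) π) ∧
    ∀ (X : CategoryTheory.Over (AlgebraicGeometry.Spec (CommRingCat.of k)))
      (π : SLScheme k n ⟶ X) (h : IsGroupQuotient (SOIncl Q) π),
      ¬ h.torsor.IsZariskiLocallyTrivial ∧
      ∃ _ : AlgebraicGeometry.IsIntegral X.left,
        GTorsor.H1.res (genericIncl X) h.torsor.cls ≠ GTorsor.H1.triv (SOScheme Q) _ := by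
  have h2 : (2 : k) ≠ 0 := Ring.two_ne_zero hk
  have hn₀ : 0 < n := by omega
  refine ⟨⟨_, _, congrMap_isGroupQuotient hn₀ h2 hQ.inv (Matrix.mul_nonsing_inv _ hQdet)⟩,
    fun X π h ↦ ?_⟩
  have hX := h.isIntegral hn₀ h2 hQ hQdet
  -- Zariski-local triviality and triviality of the generic class are both refuted by the absence of
  -- a section at the generic point.
  refine ⟨fun hZ ↦ h.not_exists_generic_section hn h2 hQ hQdet hZ.exists_generic_section, hX,
    fun hres ↦ ?_⟩
  obtain ⟨s, hs⟩ := h.torsor.exists_section_of_res_eq_triv _ hres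
  exact h.not_exists_generic_section hn h2 hQ hQdet ⟨s.left, congrArg (·.left) hs⟩
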